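/- Let $n\ge 3$ and $1\le p<\infty$. Let $w:[0,\infty)\to[0,\infty)$ be continuous, increasing and differentiable with $w(0)=0$, $w(1)=1$, $w(2t)\le Cw(t)$ for all $t>0$ and some constant $C$, such that $w'$ is increasing on $(0,1)$ and $\lim_{t\to0^+}w'(t)=0$. Let $$\Omega=\Omega^n_w=\{(t,x)\in\mathbb R\times\mathbb R^{n-1}:0<t\le1,\ |x|<w(t)\}\cup B((2,0),\sqrt2).$$ For $0<s<t$ write $A(0;s,t)=B(0,t)\setminus B(0,s)$, and for $E,F\subset\overline U$ bounded with $\mathrm{dist}(E,F)>0$, $U\subset\mathbb R^n$ a domain, put $$\mathrm{Cap}_p(E,F;U)=\inf\int_U|\nabla u|^p\,dx,$$ the infimum being over all $u\in W^{1,p}(U)\cap C(U\cup E\cup F)$ with $u\ge1$ on $E$ and $u\le0$ on $F$. Write $A\sim_cB$ if $\frac1cA\le B\le cA$. For $0<r<1$ let $$K(r)=\mathrm{Cap}_p\big(\Omega\cap B(0,\tfrac r4),\,A(0;\tfrac r2,\tfrac{3r}4);\,B(0,r)\big),\qquad K_\Omega(r)=\mathrm{Cap}_p\big(\Omega\cap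 B(0,\tfrac r4),\,\Omega\cap A(0;\tfrac r2,\tfrac{3r}4);\,B(0,r)\big).$$ Then there is a constant $c>1$, independent of $r$, such that for every $0<r<1$: 1. $K_\Omega(r)\sim_cK(r)$; 2. if $p>n-1$, then $K(r)\sim_c r^{n-p}$; 3. if $p=n-1$, then $K(r)\le c\,\dfrac{r}{\log^{n-2}\frac r{w(r)}}$; 4. if $1\le p<n-1$, then $K(r)\sim_c r\,w(r)^{n-1-p}$. Moreover, if $p=n-1$, then for every $0<r_0<1$ there is a constant $c>1$ such that $K(r)\sim_c\dfrac{r}{\log^{n-2}\frac{r}{w(r)}}$ for every $0<r\le r_0$. -/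

import Mathlib

open MeasureTheory Set Filter Topology
open scoped ENNReal NNReal ContDiff

/-- `g` is a weak gradient of `u` on the open set `Ω`: for every test function `φ ∈ C_c^∞(Ω)` and
every direction `v`, `∫_Ω u ∂_v φ = - ∫_Ω ⟨g, v⟩ φ`. It is used together with integrability of
`u` and `g` on `Ω` (see `IsSobolevPair`). -/
def IsWeakGradient {n : ℕ} (Ω : Set (EuclideanSpace ℝ (Fin n)))
    (u : EuclideanSpace ℝ (Fin n) → ℝ)
    (g : EuclideanSpace ℝ (Fin n) → EuclideanSpace ℝ (Fin n)) : Prop :=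
  ∀ φ : EuclideanSpace ℝ (Fin n) → ℝ, ContDiff ℝ ∞ φ → HasCompactSupport φ → tsupport φ ⊆ Ω →
    ∀ v : EuclideanSpace ℝ (Fin n),
      ∫ x in Ω, u x * fderiv ℝ φ x v = - ∫ x in Ω, inner ℝ (g x) v * φ x

/-- `u ∈ W^{1,p}(Ω)` with weak gradient `g` (which is unique almost everywhere in `Ω`). -/
structure IsSobolevPair {n : ℕ} (p : ℝ) (Ω : Set (EuclideanSpace ℝ (Fin n)))
    (u : EuclideanSpace ℝ (Fin n) → ℝ)
    (g : EuclideanSpace ℝ (Fin n) → EuclideanSpace ℝ (Fin n)) : Prop where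
  memLp_fun : MemLp u (ENNReal.ofReal p) (volume.restrict Ω)
  memLp_grad : MemLp g (ENNReal.ofReal p) (volume.restrict Ω)
  weakGradient : IsWeakGradient Ω u g

/-- `u` (with weak gradient `g`) is admissible for the triple `(E, F; Ω)`:
`u ∈ W^{1,p}(Ω) ∩ C(Ω ∪ E ∪ F)`, `u ≥ 1` on `E` and `u ≤ 0` on `F`. -/
structure IsAdmissible {n : ℕ} (p : ℝ) (E F Ω : Set (EuclideanSpace ℝ (Fin n)))
    (u : EuclideanSpace ℝ (Fin n) → ℝ)
    (g : EuclideanSpace ℝ (Fin n) → EuclideanSpace ℝ (Fin n)) : Prop where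
  sobolev : IsSobolevPair p Ω u g
  continuousOn : ContinuousOn u (Ω ∪ E ∪ F)
  one_le : ∀ x ∈ E, 1 ≤ u x
  le_zero : ∀ x ∈ F, u x ≤ 0

/-- The variational `p`-capacity `Cap_p(E, F; Ω) = inf ∫_Ω |∇u|^p`, the infimum being over all
admissible functions, as an extended nonnegative number. -/
noncomputable def varCapacity {n : ℕ} (p : ℝ) (E F Ω : Set (EuclideanSpace ℝ (Fin n))) : ℝ≥0∞ :=
  ⨅ (u : EuclideanSpace ℝ (Fin n) → ℝ)
    (g : EuclideanSpace ℝ (Fin n) → EuclideanSpace ℝ (Fin n))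
    (_ : IsAdmissible p E F Ω u g), ∫⁻ x in Ω, ‖g x‖ₑ ^ p

/-- The annulus `A(x; s, t) = B(x, t) \ B(x, s)`. -/
def annulus {n : ℕ} (x : EuclideanSpace ℝ (Fin n)) (s t : ℝ) : Set (EuclideanSpace ℝ (Fin n)) :=
  Metric.ball x t \ Metric.ball x s

/-- Doubling cusp functions `w : [0, ∞) → [0, ∞)` (the values of `w` on `(-∞, 0)` are irrelevant;
nonnegativity on `[0, ∞)` follows from `w 0 = 0` and monotonicity, and one-sided differentiability
at `0` follows from the limit condition on `w'`). -/
structure IsDoublingCuspFunction (w : ℝ → ℝ) : Prop where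
  continuousOn : ContinuousOn w (Ici 0)
  monotoneOn : MonotoneOn w (Ici 0)
  differentiableAt : ∀ t, 0 < t → DifferentiableAt ℝ w t
  map_zero : w 0 = 0
  map_one : w 1 = 1
  doubling : ∃ C : ℝ, ∀ t, 0 < t → w (2 * t) ≤ C * w t
  deriv_monotoneOn : MonotoneOn (deriv w) (Ioo 0 1)
  tendsto_deriv : Tendsto (deriv w) (𝓝[>] 0) (𝓝 0)

/-- For `z = (t, x) ∈ ℝ × ℝ^{n-1}`, where `t` is the coordinate with index `0`: the Euclidean norm
of `x`. -/
noncomputable def transversalNorm {n : ℕ} [NeZero n] (z : EuclideanSpace ℝ (Fin n)) : ℝ :=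
  Real.sqrt (∑ i ∈ Finset.univ.erase (0 : Fin n), z i ^ 2)

/-- The outward cusp domain
`{(t, x) ∈ ℝ × ℝ^{n-1} : 0 < t ≤ 1, |x| < w(t)} ∪ B((2, 0), √2)`. -/
noncomputable def outwardCusp (n : ℕ) [NeZero n] (w : ℝ → ℝ) : Set (EuclideanSpace ℝ (Fin n)) :=
  {z | 0 < z 0 ∧ z 0 ≤ 1 ∧ transversalNorm z < w (z 0)} ∪
    Metric.ball (EuclideanSpace.single (0 : Fin n) (2 : ℝ)) (Real.sqrt 2)

/-- `A ∼_c B`, that is, `(1/c) A ≤ B ≤ c A`. -/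
def Comparable (c : ℝ≥0) (A B : ℝ≥0∞) : Prop :=
  A / (c : ℝ≥0∞) ≤ B ∧ B ≤ (c : ℝ≥0∞) * A

/-- `Cap_p(Ω ∩ B(0, r/4), A(0; r/2, 3r/4); B(0, r))` for the cusp domain `Ω`. -/
noncomputable def cuspCapacity (n : ℕ) [NeZero n] (w : ℝ → ℝ) (p r : ℝ) : ℝ≥0∞ :=
  varCapacity p (outwardCusp n w ∩ Metric.ball 0 (r / 4)) (annulus 0 (r / 2) (3 * r / 4))
    (Metric.ball 0 r)

/-- `Cap_p(Ω ∩ B(0, r/4), Ω ∩ A(0; r/2, 3r/4); B(0, r))` for the cusp domain `Ω`. -/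
noncomputable def cuspCapacityInside (n : ℕ) [NeZero n] (w : ℝ → ℝ) (p r : ℝ) : ℝ≥0∞ :=
  varCapacity p (outwardCusp n w ∩ Metric.ball 0 (r / 4))
    (outwardCusp n w ∩ annulus 0 (r / 2) (3 * r / 4)) (Metric.ball 0 r)

/-! ### Distance to the axis, cylinders and a layer-cake estimate. -/

section Geometry

variable {n : ℕ} [NeZero n]

/-! Since `cuspCapacityInside ≤ cuspCapacity`, it suffices to bound the larger capacity above and
the smaller one below by multiples of the same quantity `Φ r`; `exists_comparable` then yields every
comparison at once.

Upper bounds come from Lipschitz competitors on `B(0, r)`. The part of the cusp in `B(0, r/4)` lies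
in the cylinder `s ≤ w r`, where `s` is the distance to the axis. A radial cutoff has energy of
order `r ^ (n - p)`; its minimum with a cutoff in `s` at scale `w r` has energy of order `r * w r ^
(n - 1 - p)`; its product with a normalised `log (r / s)`, truncated at `s = w r`, has the
logarithmic energy when `p = n - 1`.

Lower bounds come from duality. With `a = w (r / 8)`, the cusp contains two thin cylinders `s < a`,
one inside each plate. A smooth compactly supported field `V` in `B(0, r)` has its divergence
supported there, nonnegative in the first and nonpositive in the second. Hence, for admissible `u`
with weak gradient `g`, `c ≤ ∫ u div V = -∫ ⟨g, V⟩`. The field spreads from radius `a` to radius `r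
/ 2` like `x / |x| ^ (n - 1)`, so `|V| ≲ r⁻¹ max(a, s) ^ (-(n - 2))`
(`exists_abs_spreadingField_le`, `exists_le_mul_lintegral_gradient`).

Hölder's inequality leaves the integral of `max(a, s) ^ (-β)`, `β = (n - 2) p / (p - 1)`. With `γ =
n - 1 - β`, it is governed by the scale `r` if `γ > 0`, by the scale `a` if `γ < 0`, and by a
logarithm if `γ = 0`; these are the cases `p > n - 1`, `p < n - 1` and `p = n - 1`. For `p = 1` a
supremum bound replaces Hölder. Doubling makes `w (r / 8)` and `w r` interchangeable. -/

theorem transversalNorm_nonneg (z : EuclideanSpace ℝ (Fin n)) : 0 ≤ transversalNorm z :=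
  Real.sqrt_nonneg _

theorem transversalNorm_sq (z : EuclideanSpace ℝ (Fin n)) :
    transversalNorm z ^ 2 = ∑ i ∈ Finset.univ.erase (0 : Fin n), z i ^ 2 :=
  Real.sq_sqrt (Finset.sum_nonneg fun _ _ => sq_nonneg _)

theorem norm_sq_eq_add_transversalNorm_sq (z : EuclideanSpace ℝ (Fin n)) :
    ‖z‖ ^ 2 = z 0 ^ 2 + transversalNorm z ^ 2 := by
  rw [transversalNorm_sq, EuclideanSpace.real_norm_sq_eq,
    Finset.add_sum_erase _ (fun i => z i ^ 2) (Finset.mem_univ 0)]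

theorem transversalNorm_le_norm (z : EuclideanSpace ℝ (Fin n)) : transversalNorm z ≤ ‖z‖ := by
  refine abs_le_of_sq_le_sq' ?_ (norm_nonneg z) |>.2
  rw [norm_sq_eq_add_transversalNorm_sq]
  nlinarith [sq_nonneg (z 0)]

theorem abs_coord_zero_le_norm (z : EuclideanSpace ℝ (Fin n)) : |z 0| ≤ ‖z‖ := by
  refine abs_le_of_sq_le_sq ?_ (norm_nonneg z)
  rw [norm_sq_eq_add_transversalNorm_sq]
  nlinarith [sq_nonneg (transversalNorm z)]

theorem abs_coord_le_transversalNorm (z : EuclideanSpace ℝ (Fin n)) {i : Fin n} (hi : i ≠ 0) :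
    |z i| ≤ transversalNorm z := by
  refine Real.abs_le_sqrt ?_
  exact Finset.single_le_sum (f := fun i => z i ^ 2) (fun _ _ => sq_nonneg _)
    (Finset.mem_erase.2 ⟨hi, Finset.mem_univ _⟩)

theorem transversalNorm_eq_norm_sub (z : EuclideanSpace ℝ (Fin n)) :
    transversalNorm z = ‖z - EuclideanSpace.single 0 (z 0)‖ := by
  rw [← abs_of_nonneg (transversalNorm_nonneg z), ← abs_of_nonneg (norm_nonneg (z - _)),
    ← sq_eq_sq_iff_abs_eq_abs, norm_sq_eq_add_transversalNorm_sq, transversalNorm_sq,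
    transversalNorm_sq]
  simp only [PiLp.sub_apply, PiLp.single_apply, if_true, sub_self]
  rw [zero_pow two_ne_zero, zero_add]
  refine Finset.sum_congr rfl fun i hi => ?_
  rw [if_neg (Finset.ne_of_mem_erase hi), sub_zero]

theorem abs_transversalNorm_sub_le (x y : EuclideanSpace ℝ (Fin n)) :
    |transversalNorm x - transversalNorm y| ≤ ‖x - y‖ := by
  rw [transversalNorm_eq_norm_sub x, transversalNorm_eq_norm_sub y]
  refine (abs_norm_sub_norm_le _ _).trans (le_trans (le_of_eq ?_) (transversalNorm_le_norm (x - y)))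
  rw [transversalNorm_eq_norm_sub]
  congr 1
  ext i
  by_cases hi : i = 0 <;> simp [hi]

theorem lipschitzWith_transversalNorm :
    LipschitzWith 1 (transversalNorm : EuclideanSpace ℝ (Fin n) → ℝ) :=
  LipschitzWith.of_dist_le_mul fun x y => by
    simpa [Real.dist_eq, dist_eq_norm] using abs_transversalNorm_sub_le x y

theorem continuous_transversalNorm :
    Continuous (transversalNorm : EuclideanSpace ℝ (Fin n) → ℝ) :=
  lipschitzWith_transversalNorm.continuous

/-- The solid cylinder around the first coordinate axis. -/
def solidCylinder (n : ℕ) [NeZero n] (ρ τ : ℝ) : Set (EuclideanSpace ℝ (Fin n)) :=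
  {z | |z 0| ≤ ρ ∧ transversalNorm z ≤ τ}

theorem measurableSet_solidCylinder (ρ τ : ℝ) : MeasurableSet (solidCylinder n ρ τ) := by
  refine IsClosed.measurableSet (IsClosed.inter ?_ ?_)
  · exact isClosed_le (f := fun z : EuclideanSpace ℝ (Fin n) => |z 0|) (by fun_prop) continuous_const
  · exact isClosed_le continuous_transversalNorm continuous_const

theorem ball_subset_solidCylinder (r : ℝ) :
    Metric.ball (0 : EuclideanSpace ℝ (Fin n)) r ⊆ solidCylinder n r r := fun z hz => by
  rw [mem_ball_zero_iff] at hz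
  exact ⟨(abs_coord_zero_le_norm z).trans hz.le, (transversalNorm_le_norm z).trans hz.le⟩

theorem volume_solidCylinder_le {ρ τ : ℝ} (hρ : 0 ≤ ρ) (hτ : 0 ≤ τ) :
    volume (solidCylinder n ρ τ) ≤ ENNReal.ofReal (2 * ρ * (2 * τ) ^ (n - 1)) := by
  set b : Fin n → ℝ := fun i => if i = 0 then ρ else τ
  have hsub : solidCylinder n ρ τ ⊆ (WithLp.ofLp : EuclideanSpace ℝ (Fin n) → _) ⁻¹'
      Icc (fun i => -b i) b := by
    rintro z ⟨h0, hs⟩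
    have : ∀ i, |z i| ≤ b i := fun i => by
      by_cases hi : i = 0
      · simpa [b, hi] using h0
      · simpa [b, hi] using (abs_coord_le_transversalNorm z hi).trans hs
    exact ⟨fun i => (abs_le.1 (this i)).1, fun i => (abs_le.1 (this i)).2⟩
  refine (measure_mono hsub).trans ?_
  rw [(PiLp.volume_preserving_ofLp (Fin n)).measure_preimage measurableSet_Icc.nullMeasurableSet,
    Real.volume_Icc_pi, ← ENNReal.ofReal_prod_of_nonneg]
  · refine ENNReal.ofReal_le_ofReal (le_of_eq ?_)
    rw [← Finset.mul_prod_erase _ _ (Finset.mem_univ (0 : Fin n)),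
      Finset.prod_congr rfl (g := fun _ => 2 * τ), Finset.prod_const,
      Finset.card_erase_of_mem (Finset.mem_univ _), Finset.card_univ, Fintype.card_fin]
    · simp only [b, if_true]; ring
    · intro i hi
      simp only [b, if_neg (Finset.ne_of_mem_erase hi)]; ring
  · intro i _
    simp only [b]; split_ifs <;> linarith

/-- Layer-cake bound for negative powers of the truncated distance to the axis. -/
theorem lintegral_max_transversalNorm_rpow_neg_le {a r β : ℝ} (ha : 0 < a) (har : a ≤ r)
    (hβ : 0 < β) :
    ∫⁻ z in solidCylinder n r r, ENNReal.ofReal (max a (transversalNorm z) ^ (-β)) ≤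
      ENNReal.ofReal (2 ^ n * r * (r ^ (((n - 1 : ℕ) : ℝ) - β) +
        β * ∫ τ in a..r, τ ^ (((n - 1 : ℕ) : ℝ) - β - 1))) := by
  have hr : 0 < r := ha.trans_le har
  set N : ℝ := ((n - 1 : ℕ) : ℝ)
  have hdens : ∀ x, 0 < x → 0 ≤ β * x ^ (-β - 1) := fun x hx => by positivity
  have hcont : ∀ γ : ℝ, ContinuousOn (fun τ : ℝ => τ ^ γ) (Icc a r) := fun γ τ hτ =>
    (Real.continuousAt_rpow_const _ _ (Or.inl (ha.trans_le hτ.1).ne')).continuousWithinAt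
  -- With `M = max a s`, this is `M ^ (-β) = r ^ (-β) + ∫_M^r β τ ^ (-β - 1) dτ`, the integral being
  -- written over `(a, r]` with the indicator of `s ≤ τ`. After Tonelli the inner integral is the
  -- volume of a cylinder of radius `τ`.
  have hpt : ∀ z ∈ solidCylinder n r r, ENNReal.ofReal (max a (transversalNorm z) ^ (-β)) ≤
      ENNReal.ofReal (r ^ (-β)) + ∫⁻ τ in Ioc a r,
        (Ici (transversalNorm z)).indicator (fun τ => ENNReal.ofReal (β * τ ^ (-β - 1))) τ := by
    rintro z ⟨-, hz⟩
    set M := max a (transversalNorm z)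
    have hM : 0 < M := ha.trans_le (le_max_left _ _)
    have hMr : M ≤ r := max_le har hz
    have hint : ∫ τ in M..r, β * τ ^ (-β - 1) = M ^ (-β) - r ^ (-β) := by
      rw [intervalIntegral.integral_const_mul, integral_rpow]
      · rw [show -β - 1 + 1 = -β by ring]
        field_simp
        ring
      · right
        refine ⟨by linarith, ?_⟩
        rw [uIcc_of_le hMr]
        exact fun h => (hM.trans_le h.1).ne' rfl
    have hI : IntervalIntegrable (fun τ => β * τ ^ (-β - 1)) volume M r := by
      refine ContinuousOn.intervalIntegrable ?_
      rw [uIcc_of_le hMr]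
      exact (continuousOn_const.mul ((hcont _).mono (Icc_subset_Icc_left (le_max_left _ _))))
    have h2 : ENNReal.ofReal (M ^ (-β) - r ^ (-β)) =
        ∫⁻ τ in Ioc M r, ENNReal.ofReal (β * τ ^ (-β - 1)) := by
      rw [← hint, intervalIntegral.integral_of_le hMr, ofReal_integral_eq_lintegral_ofReal]
      · exact (intervalIntegrable_iff_integrableOn_Ioc_of_le hMr).1 hI
      · filter_upwards [ae_restrict_mem measurableSet_Ioc] with τ hτ
        exact hdens τ (hM.trans hτ.1)
    have h3 : M ^ (-β) = r ^ (-β) + (M ^ (-β) - r ^ (-β)) := by ring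
    rw [h3, ENNReal.ofReal_add (by positivity)]
    · gcongr
      rw [h2, ← lintegral_indicator measurableSet_Ioc, ← lintegral_indicator measurableSet_Ioc]
      refine lintegral_mono fun τ => ?_
      refine indicator_le (fun τ hτ => ?_) τ
      rw [indicator_of_mem (show τ ∈ Ioc a r from ⟨(le_max_left _ _).trans_lt hτ.1, hτ.2⟩),
        indicator_of_mem (show τ ∈ Ici (transversalNorm z) from ((le_max_right _ _).trans hτ.1.le))]
    · exact sub_nonneg.2 (Real.rpow_le_rpow_of_nonpos hM hMr (by linarith))
  refine (setLIntegral_mono' (measurableSet_solidCylinder r r) hpt).trans ?_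
  rw [lintegral_add_left measurable_const, setLIntegral_const]
  have hmeas : Measurable (Function.uncurry fun (z : EuclideanSpace ℝ (Fin n)) (τ : ℝ) =>
      (Ici (transversalNorm z)).indicator (fun τ => ENNReal.ofReal (β * τ ^ (-β - 1))) τ) := by
    have : (Function.uncurry fun (z : EuclideanSpace ℝ (Fin n)) (τ : ℝ) =>
        (Ici (transversalNorm z)).indicator (fun τ => ENNReal.ofReal (β * τ ^ (-β - 1))) τ) =
        {q : EuclideanSpace ℝ (Fin n) × ℝ | transversalNorm q.1 ≤ q.2}.indicator
          (fun q => ENNReal.ofReal (β * q.2 ^ (-β - 1))) := by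
      ext ⟨z, τ⟩
      simp [indicator]
    rw [this]
    refine Measurable.indicator (by fun_prop) ?_
    exact (isClosed_le (continuous_transversalNorm.comp continuous_fst) continuous_snd).measurableSet
  rw [lintegral_lintegral_swap hmeas.aemeasurable]
  have hVr := volume_solidCylinder_le (n := n) hr.le hr.le
  have hn : n - 1 + 1 = n := Nat.sub_add_cancel (Nat.one_le_iff_ne_zero.2 (NeZero.ne n))
  have hinner : ∀ τ ∈ Ioc a r, ∫⁻ z in solidCylinder n r r,
      (Ici (transversalNorm z)).indicator (fun τ => ENNReal.ofReal (β * τ ^ (-β - 1))) τ ≤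
      ENNReal.ofReal (2 ^ n * r * β * τ ^ (N - β - 1)) := by
    intro τ hτ
    have hτ0 := ha.trans hτ.1
    have : ∀ z : EuclideanSpace ℝ (Fin n), (Ici (transversalNorm z)).indicator
        (fun τ => ENNReal.ofReal (β * τ ^ (-β - 1))) τ =
        {z | transversalNorm z ≤ τ}.indicator (fun _ => ENNReal.ofReal (β * τ ^ (-β - 1))) z :=
      fun z => by simp [indicator]
    simp_rw [this]
    have hm : MeasurableSet {z : EuclideanSpace ℝ (Fin n) | transversalNorm z ≤ τ} :=
      (isClosed_le continuous_transversalNorm continuous_const).measurableSet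
    rw [lintegral_indicator_const hm, Measure.restrict_apply hm]
    calc _ ≤ ENNReal.ofReal (β * τ ^ (-β - 1)) * volume (solidCylinder n r τ) := by
            gcongr
            exact fun z hz => ⟨hz.2.1, hz.1⟩
      _ ≤ ENNReal.ofReal (β * τ ^ (-β - 1)) * ENNReal.ofReal (2 * r * (2 * τ) ^ (n - 1)) := by
            gcongr
            exact volume_solidCylinder_le hr.le hτ0.le
      _ = _ := by
            rw [← ENNReal.ofReal_mul (hdens τ hτ0)]
            congr 1
            have : τ ^ (N - β - 1) = τ ^ (n - 1) * τ ^ (-β - 1) := by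
              rw [← Real.rpow_natCast, ← Real.rpow_add hτ0]; congr 1; ring
            have h2 : (2 : ℝ) ^ n = 2 * 2 ^ (n - 1) := by rw [← pow_succ', hn]
            rw [this, mul_pow, h2]; ring
  have hI : ∫⁻ τ in Ioc a r, ENNReal.ofReal (2 ^ n * r * β * τ ^ (N - β - 1)) =
      ENNReal.ofReal (2 ^ n * r * (β * ∫ τ in a..r, τ ^ (N - β - 1))) := by
    have : 2 ^ n * r * (β * ∫ τ in a..r, τ ^ (N - β - 1)) =
        ∫ τ in a..r, 2 ^ n * r * β * τ ^ (N - β - 1) := by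
      rw [intervalIntegral.integral_const_mul]; ring
    rw [this, intervalIntegral.integral_of_le har, ofReal_integral_eq_lintegral_ofReal]
    · refine (intervalIntegrable_iff_integrableOn_Ioc_of_le har).1 ?_
      refine ContinuousOn.intervalIntegrable ?_
      rw [uIcc_of_le har]
      exact continuousOn_const.mul (hcont _)
    · filter_upwards [ae_restrict_mem measurableSet_Ioc] with τ hτ
      have := ha.trans hτ.1
      positivity
  calc _ ≤ ENNReal.ofReal (2 ^ n * r * r ^ (N - β)) +
        ENNReal.ofReal (2 ^ n * r * (β * ∫ τ in a..r, τ ^ (N - β - 1))) := by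
          refine add_le_add ?_ ((setLIntegral_mono' measurableSet_Ioc hinner).trans hI.le)
          refine (mul_le_mul_right hVr _).trans (le_of_eq ?_)
          rw [← ENNReal.ofReal_mul (by positivity)]
          congr 1
          have h2 : (2 : ℝ) ^ n = 2 * 2 ^ (n - 1) := by rw [← pow_succ', hn]
          rw [sub_eq_add_neg, Real.rpow_add hr, Real.rpow_natCast, h2, mul_pow]; ring
    _ = _ := by
          rw [← ENNReal.ofReal_add]
          · congr 1; ring
          · positivity
          · have : 0 ≤ ∫ τ in a..r, τ ^ (N - β - 1) :=
              intervalIntegral.integral_nonneg har fun τ hτ =>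
                Real.rpow_nonneg (ha.le.trans hτ.1) _
            positivity

end Geometry

/-! ### Upper bounds for capacities from Lipschitz competitors. -/

section LipschitzCompetitors

variable {n : ℕ}

theorem norm_gradient (u : EuclideanSpace ℝ (Fin n) → ℝ) (x : EuclideanSpace ℝ (Fin n)) :
    ‖gradient u x‖ = ‖fderiv ℝ u x‖ := by
  rw [gradient, LinearIsometryEquiv.norm_map]

theorem measurable_gradient (u : EuclideanSpace ℝ (Fin n) → ℝ) : Measurable (gradient u) :=
  (InnerProductSpace.toDual ℝ (EuclideanSpace ℝ (Fin n))).symm.continuous.measurable.comp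
    (measurable_fderiv ℝ u)

/-- By Rademacher the pointwise gradient represents the line derivatives almost everywhere, and
these can be integrated by parts against a compactly supported Lipschitz function. -/
theorem LipschitzWith.isWeakGradient {K : ℝ≥0} {u : EuclideanSpace ℝ (Fin n) → ℝ}
    (hu : LipschitzWith K u) (Ω : Set (EuclideanSpace ℝ (Fin n))) :
    IsWeakGradient Ω u (gradient u) := by
  intro φ hφ hc hsupp v
  obtain ⟨D, hD⟩ := hφ.lipschitzWith_of_hasCompactSupport hc (by simp)
  have hout : ∀ x, x ∉ Ω → φ x = 0 := fun x hx => image_eq_zero_of_notMem_tsupport fun h => hx (hsupp h)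
  have hout' : ∀ x, x ∉ Ω → fderiv ℝ φ x = 0 := fun x hx => by
    by_contra h
    exact hx (hsupp (support_fderiv_subset ℝ h))
  rw [setIntegral_eq_integral_of_forall_compl_eq_zero fun x hx => by simp [hout' x hx],
    setIntegral_eq_integral_of_forall_compl_eq_zero fun x hx => by simp [hout x hx]]
  have h := LipschitzWith.integral_lineDeriv_mul_eq (μ := volume) hu hD hc v
  have h1 : ∫ x, inner ℝ (gradient u x) v * φ x = ∫ x, lineDeriv ℝ u x v * φ x := by
    refine integral_congr_ae ?_
    filter_upwards [hu.ae_differentiableAt (μ := volume)] with x hx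
    rw [hx.lineDeriv_eq_fderiv, gradient, InnerProductSpace.toDual_symm_apply]
  rw [h1, h, ← integral_neg]
  refine integral_congr_ae (Eventually.of_forall fun x => ?_)
  simp only
  rw [((hφ.differentiable (by simp)) x).lineDeriv_eq_fderiv, map_neg]
  ring

theorem varCapacity_le_of_lipschitzWith {p r : ℝ} {E F : Set (EuclideanSpace ℝ (Fin n))}
    {K : ℝ≥0} {u : EuclideanSpace ℝ (Fin n) → ℝ} (hu : LipschitzWith K u)
    (hE : ∀ x ∈ E, 1 ≤ u x) (hF : ∀ x ∈ F, u x ≤ 0) :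
    varCapacity p E F (Metric.ball 0 r) ≤ ∫⁻ x in Metric.ball 0 r, ‖gradient u x‖ₑ ^ p := by
  have : IsFiniteMeasure (volume.restrict (Metric.ball (0 : EuclideanSpace ℝ (Fin n)) r)) :=
    ⟨by simpa using measure_ball_lt_top⟩
  refine iInf_le_of_le u (iInf_le_of_le (gradient u) (iInf_le_of_le ⟨⟨?_, ?_, ?_⟩, ?_, hE, hF⟩ le_rfl))
  · refine MemLp.of_bound hu.continuous.aestronglyMeasurable (‖u 0‖ + K * r) ?_
    filter_upwards [ae_restrict_mem measurableSet_ball] with x hx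
    have h := hu.dist_le_mul x 0
    rw [dist_zero_right, dist_eq_norm] at h
    rw [mem_ball_zero_iff] at hx
    have h2 : ‖u x‖ ≤ ‖u 0‖ + ‖u x - u 0‖ := by simpa using norm_add_le (u 0) (u x - u 0)
    have := mul_le_mul_of_nonneg_left hx.le K.2
    exact h2.trans (by simpa using h.trans this)
  · refine MemLp.of_bound (measurable_gradient u).aestronglyMeasurable K ?_
    exact Eventually.of_forall fun x => by
      rw [norm_gradient]; exact norm_fderiv_le_of_lipschitz ℝ hu
  · exact hu.isWeakGradient _
  · exact hu.continuous.continuousOn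

/-- A local Lipschitz estimate centred at `x` suffices: where `u` is not differentiable, `fderiv` is
`0` by default. -/
theorem enorm_gradient_rpow_le {p C : ℝ} (hp : 0 ≤ p) (hC : 0 ≤ C)
    {u : EuclideanSpace ℝ (Fin n) → ℝ} {x : EuclideanSpace ℝ (Fin n)}
    (h : ∀ᶠ y in 𝓝 x, |u y - u x| ≤ C * ‖y - x‖) :
    ‖gradient u x‖ₑ ^ p ≤ ENNReal.ofReal (C ^ p) := by
  rw [← ENNReal.ofReal_rpow_of_nonneg hC hp, ← ofReal_norm, norm_gradient]
  gcongr
  exact norm_fderiv_le_of_lip' ℝ hC h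

/-- A radial Lipschitz function which is `1` on `B(0, r/4)` and vanishes off `B(0, r/2)`. -/
noncomputable def radialCutoff (n : ℕ) (r : ℝ) (z : EuclideanSpace ℝ (Fin n)) : ℝ :=
  max 0 (min 1 (2 - 4 * ‖z‖ / r))

theorem abs_clamp_sub_le (a b : ℝ) : |max 0 (min 1 a) - max 0 (min 1 b)| ≤ |a - b| := by
  refine (abs_max_sub_max_le_max 0 (min 1 a) 0 (min 1 b)).trans ?_
  rw [sub_self, abs_zero, max_eq_right (abs_nonneg _)]
  refine (abs_min_sub_min_le_max 1 a 1 b).trans ?_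
  simp

theorem radialCutoff_nonneg (r : ℝ) (z : EuclideanSpace ℝ (Fin n)) : 0 ≤ radialCutoff n r z :=
  le_max_left _ _

theorem radialCutoff_le_one (r : ℝ) (z : EuclideanSpace ℝ (Fin n)) : radialCutoff n r z ≤ 1 :=
  max_le zero_le_one (min_le_left _ _)

theorem abs_radialCutoff_sub_le {r : ℝ} (hr : 0 < r) (x y : EuclideanSpace ℝ (Fin n)) :
    |radialCutoff n r x - radialCutoff n r y| ≤ 4 / r * ‖x - y‖ := by
  refine (abs_clamp_sub_le _ _).trans ?_
  have : 2 - 4 * ‖x‖ / r - (2 - 4 * ‖y‖ / r) = 4 / r * (‖y‖ - ‖x‖) := by ring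
  rw [this, abs_mul, abs_of_pos (by positivity), norm_sub_rev x y]
  gcongr
  exact abs_norm_sub_norm_le _ _

theorem radialCutoff_eq_one {r : ℝ} (hr : 0 < r) {z : EuclideanSpace ℝ (Fin n)}
    (hz : ‖z‖ ≤ r / 4) : radialCutoff n r z = 1 := by
  have : 1 ≤ 2 - 4 * ‖z‖ / r := by
    have : 4 * ‖z‖ / r ≤ 1 := by rw [div_le_one hr]; linarith
    linarith
  rw [radialCutoff, min_eq_left this, max_eq_right zero_le_one]

theorem radialCutoff_eq_zero {r : ℝ} (hr : 0 < r) {z : EuclideanSpace ℝ (Fin n)}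
    (hz : r / 2 ≤ ‖z‖) : radialCutoff n r z = 0 := by
  have : 2 - 4 * ‖z‖ / r ≤ 0 := by
    have : 2 ≤ 4 * ‖z‖ / r := by rw [le_div_iff₀ hr]; linarith
    linarith
  rw [radialCutoff, max_eq_left ((min_le_right _ _).trans this)]

theorem varCapacity_le_radial [NeZero n] {p r : ℝ} (hp : 0 ≤ p) (hr : 0 < r)
    {E F : Set (EuclideanSpace ℝ (Fin n))} (hE : ∀ x ∈ E, ‖x‖ ≤ r / 4)
    (hF : ∀ x ∈ F, r / 2 ≤ ‖x‖) :
    varCapacity p E F (Metric.ball 0 r) ≤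
      ENNReal.ofReal ((4 / r) ^ p * (2 * r * (2 * r) ^ (n - 1))) := by
  have hL : LipschitzWith (Real.toNNReal (4 / r)) (radialCutoff n r) :=
    LipschitzWith.of_dist_le_mul fun x y => by
      rw [Real.coe_toNNReal _ (by positivity), Real.dist_eq, dist_eq_norm]
      exact abs_radialCutoff_sub_le hr x y
  refine (varCapacity_le_of_lipschitzWith hL (fun x hx => (radialCutoff_eq_one hr (hE x hx)).ge)
    fun x hx => (radialCutoff_eq_zero hr (hF x hx)).le).trans ?_
  refine (lintegral_mono fun x => enorm_gradient_rpow_le (C := 4 / r) hp (by positivity)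
    (Eventually.of_forall fun y => abs_radialCutoff_sub_le hr y x)).trans ?_
  rw [setLIntegral_const, ENNReal.ofReal_mul (by positivity)]
  gcongr
  exact (measure_mono (ball_subset_solidCylinder r)).trans (volume_solidCylinder_le hr.le hr.le)

/-- The competitor is the minimum of the radial cutoff (slope `4 / r ≤ 4 / b`) and a cutoff in `s`
falling from `1` at `s = b` to `0` at `s = 2 * b`. Its gradient lives in the cylinder of radius `2 *
b`. -/
theorem varCapacity_le_cylindrical [NeZero n] {p r b : ℝ} (hp : 0 < p) (hb : 0 < b) (hbr : b ≤ r)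
    {E F : Set (EuclideanSpace ℝ (Fin n))} (hE : ∀ x ∈ E, ‖x‖ ≤ r / 4 ∧ transversalNorm x ≤ b)
    (hF : ∀ x ∈ F, r / 2 ≤ ‖x‖) :
    varCapacity p E F (Metric.ball 0 r) ≤
      ENNReal.ofReal ((4 / b) ^ p * (2 * r * (2 * (2 * b)) ^ (n - 1))) := by
  have hr : 0 < r := hb.trans_le hbr
  set v : EuclideanSpace ℝ (Fin n) → ℝ := fun z => max 0 (min 1 (2 - transversalNorm z / b)) with hv
  set u : EuclideanSpace ℝ (Fin n) → ℝ := fun z => min (radialCutoff n r z) (v z) with hu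
  have hvL : ∀ x y, |v x - v y| ≤ 4 / b * ‖x - y‖ := fun x y => by
    refine (abs_clamp_sub_le _ _).trans ?_
    have h : 2 - transversalNorm x / b - (2 - transversalNorm y / b) =
      1 / b * (transversalNorm y - transversalNorm x) := by ring
    rw [h, abs_mul, abs_of_pos (by positivity), norm_sub_rev x y]
    gcongr
    · norm_num
    · exact abs_transversalNorm_sub_le _ _
  have huL : ∀ x y, |u x - u y| ≤ 4 / b * ‖x - y‖ := fun x y => by
    refine (abs_min_sub_min_le_max _ _ _ _).trans (max_le ?_ (hvL x y))
    refine (abs_radialCutoff_sub_le hr x y).trans ?_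
    gcongr
  have hL : LipschitzWith (Real.toNNReal (4 / b)) u :=
    LipschitzWith.of_dist_le_mul fun x y => by
      rw [Real.coe_toNNReal _ (by positivity), Real.dist_eq, dist_eq_norm]
      exact huL x y
  refine (varCapacity_le_of_lipschitzWith hL (fun x hx => ?_) fun x hx => ?_).trans ?_
  · refine le_min (radialCutoff_eq_one hr (hE x hx).1).ge ?_
    have : transversalNorm x / b ≤ 1 := (div_le_one hb).2 (hE x hx).2
    exact le_max_of_le_right (le_min le_rfl (by linarith))
  · exact (min_le_left _ _).trans (radialCutoff_eq_zero hr (hF x hx)).le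
  have hpt : ∀ x ∈ Metric.ball (0 : EuclideanSpace ℝ (Fin n)) r, ‖gradient u x‖ₑ ^ p ≤
      (solidCylinder n r (2 * b)).indicator (fun _ => ENNReal.ofReal ((4 / b) ^ p)) x := by
    intro x hx
    by_cases hs : transversalNorm x ≤ 2 * b
    · rw [indicator_of_mem (show x ∈ solidCylinder n r (2 * b) from
        ⟨(ball_subset_solidCylinder r hx).1, hs⟩)]
      exact enorm_gradient_rpow_le hp.le (by positivity) (Eventually.of_forall fun y => huL y x)
    · refine le_trans (b := ENNReal.ofReal ((0 : ℝ) ^ p)) ?_ ?_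
      · refine enorm_gradient_rpow_le hp.le le_rfl ?_
        have hz : ∀ y, 2 * b < transversalNorm y → u y = 0 := fun y hy => by
          have : 2 - transversalNorm y / b ≤ 0 := by
            have : 2 ≤ transversalNorm y / b := by rw [le_div_iff₀ hb]; exact hy.le
            linarith
          have hv0 : v y = 0 := max_eq_left ((min_le_right _ _).trans this)
          simp only [hu]
          rw [hv0, min_eq_right (radialCutoff_nonneg _ _)]
        filter_upwards [(isOpen_lt continuous_const continuous_transversalNorm).mem_nhds
          (not_le.1 hs)] with y hy
        rw [hz y hy, hz x (not_le.1 hs)]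
        simp
      · rw [Real.zero_rpow hp.ne']
        simp
  refine (setLIntegral_mono' measurableSet_ball hpt).trans ?_
  refine (setLIntegral_le_lintegral _ _).trans ?_
  rw [lintegral_indicator_const (measurableSet_solidCylinder _ _), ENNReal.ofReal_mul (by positivity)]
  gcongr
  exact volume_solidCylinder_le hr.le (by positivity)

theorem abs_log_sub_log_le {c x y : ℝ} (hc : 0 < c) (hx : c ≤ x) (hy : c ≤ y) :
    |Real.log x - Real.log y| ≤ |x - y| / c := by
  wlog h : y ≤ x generalizing x y
  · rw [abs_sub_comm, abs_sub_comm x]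
    exact this hy hx (le_of_not_ge h)
  have hy0 := hc.trans_le hy
  have hx0 := hc.trans_le hx
  rw [abs_of_nonneg (sub_nonneg.2 (Real.log_le_log hy0 h)), abs_of_nonneg (sub_nonneg.2 h),
    ← Real.log_div hx0.ne' hy0.ne']
  calc Real.log (x / y) ≤ x / y - 1 := Real.log_le_sub_one_of_pos (by positivity)
    _ = (x - y) / y := by field_simp
    _ ≤ (x - y) / c := by gcongr

/-- The competitor is the radial cutoff times `log (r / T) / L`, where `T` is `s` clamped to `[b,
r]`. Its gradient is at most `6 / (T * L)`, which the layer-cake bound integrates. -/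
theorem varCapacity_le_logarithmic [NeZero n] {p r b : ℝ} (hp : 0 < p) (hb : 0 < b) (hbr : b < r)
    {E F : Set (EuclideanSpace ℝ (Fin n))} (hE : ∀ x ∈ E, ‖x‖ ≤ r / 4 ∧ transversalNorm x ≤ b)
    (hF : ∀ x ∈ F, r / 2 ≤ ‖x‖) :
    varCapacity p E F (Metric.ball 0 r) ≤
      ENNReal.ofReal ((6 / Real.log (r / b)) ^ p * (2 ^ n * r * (r ^ (((n - 1 : ℕ) : ℝ) - p) +
        p * ∫ τ in b..r, τ ^ (((n - 1 : ℕ) : ℝ) - p - 1)))) := by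
  have hr : 0 < r := hb.trans hbr
  set L := Real.log (r / b)
  have hL : 0 < L := Real.log_pos ((one_lt_div hb).2 hbr)
  set T : EuclideanSpace ℝ (Fin n) → ℝ := fun z => max b (min (transversalNorm z) r) with hT
  have hbT : ∀ z, b ≤ T z := fun z => le_max_left _ _
  have hT0 : ∀ z, 0 < T z := fun z => hb.trans_le (hbT z)
  have hTL : ∀ x y, |T x - T y| ≤ ‖x - y‖ := fun x y => by
    refine (abs_max_sub_max_le_max _ _ _ _).trans (max_le (by simp) ?_)
    refine (abs_min_sub_min_le_max _ _ _ _).trans (max_le ?_ (by simp))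
    exact abs_transversalNorm_sub_le x y
  have hTc : Continuous T :=
    continuous_const.max (continuous_transversalNorm.min continuous_const)
  set v : EuclideanSpace ℝ (Fin n) → ℝ := fun z => Real.log (r / T z) / L with hv
  have hvL : ∀ c x y, 0 < c → c ≤ T x → c ≤ T y → |v x - v y| ≤ 1 / (c * L) * ‖x - y‖ := by
    intro c x y hc hx hy
    have : v x - v y = (Real.log (T y) - Real.log (T x)) / L := by
      simp only [hv]
      rw [Real.log_div hr.ne' (hT0 x).ne', Real.log_div hr.ne' (hT0 y).ne']
      ring
    rw [this, abs_div, abs_of_pos hL]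
    calc _ ≤ |T y - T x| / c / L := by gcongr; exact abs_log_sub_log_le hc hy hx
      _ ≤ ‖y - x‖ / c / L := by gcongr; exact hTL y x
      _ = _ := by rw [norm_sub_rev]; field_simp
  -- The crude bound `log x ≤ x` makes the term that differentiates the radial cutoff, of slope `4 /
  -- r`, no worse than `4 / (T * L)`.
  have hvb : ∀ z, |v z| ≤ r / (T z * L) := fun z => by
    have hTr : T z ≤ r := max_le hbr.le (min_le_right _ _)
    have h1 : 0 ≤ Real.log (r / T z) := Real.log_nonneg ((one_le_div (hT0 z)).2 hTr)
    rw [abs_of_nonneg (by positivity), ← div_div]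
    have := hT0 z
    have := Real.log_le_self (show 0 ≤ r / T z by positivity)
    simp only [hv]
    gcongr
  set u : EuclideanSpace ℝ (Fin n) → ℝ := fun z => radialCutoff n r z * v z with hu
  have huL : ∀ c x y, 0 < c → c ≤ T x → c ≤ T y →
      |u x - u y| ≤ (4 / (T y * L) + 1 / (c * L)) * ‖x - y‖ := by
    intro c x y hc hx hy
    have : u x - u y = (radialCutoff n r x - radialCutoff n r y) * v y +
      radialCutoff n r x * (v x - v y) := by simp only [hu]; ring
    rw [this]
    refine (abs_add_le _ _).trans ?_
    rw [abs_mul, abs_mul, add_mul, abs_of_nonneg (radialCutoff_nonneg r x)]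
    have hTy := hT0 y
    refine add_le_add ?_ ?_
    · calc _ ≤ (4 / r * ‖x - y‖) * (r / (T y * L)) := by
            gcongr
            · exact abs_radialCutoff_sub_le hr x y
            · exact hvb y
        _ = _ := by field_simp
    · calc _ ≤ 1 * |v x - v y| := by gcongr; exact radialCutoff_le_one r x
        _ ≤ _ := by rw [one_mul]; exact hvL c x y hc hx hy
  have hLip : LipschitzWith (Real.toNNReal (5 / (b * L))) u :=
    LipschitzWith.of_dist_le_mul fun x y => by
      rw [Real.coe_toNNReal _ (by positivity), Real.dist_eq, dist_eq_norm]
      refine (huL b x y hb (hbT x) (hbT y)).trans ?_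
      gcongr
      have : 4 / (T y * L) ≤ 4 / (b * L) := by gcongr; exact hbT y
      refine (add_le_add_left this _).trans (le_of_eq ?_)
      ring
  refine (varCapacity_le_of_lipschitzWith hLip (fun x hx => ?_) fun x hx => ?_).trans ?_
  · have hTx : T x = b := max_eq_left ((min_le_left _ _).trans (hE x hx).2)
    simp only [hu, hv]
    rw [radialCutoff_eq_one hr (hE x hx).1, hTx, div_self hL.ne', one_mul]
  · simp only [hu]
    rw [radialCutoff_eq_zero hr (hF x hx), zero_mul]
  have hpt : ∀ x ∈ Metric.ball (0 : EuclideanSpace ℝ (Fin n)) r, ‖gradient u x‖ₑ ^ p ≤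
      ENNReal.ofReal ((6 / L) ^ p) * ENNReal.ofReal (max b (transversalNorm x) ^ (-p)) := by
    intro x hx
    have hTx : T x = max b (transversalNorm x) := by
      simp only [hT]
      rw [min_eq_left (ball_subset_solidCylinder r hx).2]
    have h0 := hT0 x
    rw [← hTx, ← ENNReal.ofReal_mul (by positivity)]
    have : (6 / L) ^ p * T x ^ (-p) = (6 / (T x * L)) ^ p := by
      rw [Real.rpow_neg h0.le, ← div_eq_mul_inv, ← Real.div_rpow (by positivity) h0.le, div_div,
        mul_comm L]
    rw [this]
    refine enorm_gradient_rpow_le hp.le (by positivity) ?_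
    -- By continuity `T > T x / 2` near `x`, so `huL` applies with `c = T x / 2`; the constant is `4
    -- + 2 = 6`.
    filter_upwards [hTc.continuousAt.eventually (lt_mem_nhds (half_lt_self h0))] with y hy
    refine (huL (T x / 2) y x (by positivity) hy.le (half_le_self h0.le)).trans (le_of_eq ?_)
    field_simp
    ring
  refine (setLIntegral_mono' measurableSet_ball hpt).trans ?_
  refine (lintegral_mono_set (ball_subset_solidCylinder r)).trans ?_
  rw [lintegral_const_mul' _ _ ENNReal.ofReal_ne_top, ENNReal.ofReal_mul (by positivity)]
  gcongr
  exact lintegral_max_transversalNorm_rpow_neg_le hb hbr.le hp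

end LipschitzCompetitors

/-! ### One-variable profiles for the test field. -/

section Profiles

theorem deriv_smoothTransition_nonneg (y : ℝ) : 0 ≤ deriv Real.smoothTransition y :=
  Real.smoothTransition.monotone.deriv_nonneg

theorem hasDerivAt_smoothTransition (y : ℝ) :
    HasDerivAt Real.smoothTransition (deriv Real.smoothTransition y) y :=
  ((Real.smoothTransition.contDiff (n := 1)).differentiable (by simp) y).hasDerivAt

theorem deriv_smoothTransition_of_lt_zero {y : ℝ} (hy : y < 0) :
    deriv Real.smoothTransition y = 0 := by
  have : Real.smoothTransition =ᶠ[𝓝 y] fun _ => 0 := by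
    filter_upwards [Iio_mem_nhds hy] with x hx using Real.smoothTransition.zero_of_nonpos (le_of_lt hx)
  rw [this.deriv_eq, deriv_const]

theorem deriv_smoothTransition_of_one_lt {y : ℝ} (hy : 1 < y) :
    deriv Real.smoothTransition y = 0 := by
  have : Real.smoothTransition =ᶠ[𝓝 y] fun _ => 1 := by
    filter_upwards [Ioi_mem_nhds hy] with x hx using Real.smoothTransition.one_of_one_le (le_of_lt hx)
  rw [this.deriv_eq, deriv_const]

theorem exists_deriv_smoothTransition_pos :
    ∃ y : ℝ, 0 ≤ y ∧ y ≤ 1 ∧ 0 < deriv Real.smoothTransition y := by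
  by_contra! h
  have h0 : ∀ y, deriv Real.smoothTransition y = 0 := fun y => by
    rcases lt_or_ge y 0 with hy | hy
    · exact deriv_smoothTransition_of_lt_zero hy
    rcases lt_or_ge 1 y with hy' | hy'
    · exact deriv_smoothTransition_of_one_lt hy'
    · exact le_antisymm (h y hy hy') (deriv_smoothTransition_nonneg y)
  have := is_const_of_deriv_eq_zero
    ((Real.smoothTransition.contDiff (n := 1)).differentiable (by simp)) h0 0 1
  rw [Real.smoothTransition.zero, Real.smoothTransition.one] at this
  exact zero_ne_one this

/-- A smooth function on the line rising from `0` to `1` on `[2, 3]` and falling back to `0` on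
`[8, 10]`. -/
noncomputable def axialProfile (y : ℝ) : ℝ :=
  Real.smoothTransition (y - 2) - Real.smoothTransition ((y - 8) / 2)

theorem contDiff_axialProfile : ContDiff ℝ ∞ axialProfile :=
  (Real.smoothTransition.contDiff.comp (contDiff_id.sub contDiff_const)).sub
    (Real.smoothTransition.contDiff.comp ((contDiff_id.sub contDiff_const).div_const 2))

theorem contDiff_deriv_axialProfile : ContDiff ℝ ∞ (deriv axialProfile) :=
  (contDiff_infty_iff_deriv.1 contDiff_axialProfile).2

theorem deriv_axialProfile (y : ℝ) : deriv axialProfile y =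
    deriv Real.smoothTransition (y - 2) - deriv Real.smoothTransition ((y - 8) / 2) / 2 := by
  have h1 := (hasDerivAt_smoothTransition (y - 2)).comp y ((hasDerivAt_id y).sub_const 2)
  have h2 := (hasDerivAt_smoothTransition ((y - 8) / 2)).comp y
    (((hasDerivAt_id y).sub_const 8).div_const 2)
  have h := (h1.sub h2).deriv
  rw [mul_one, mul_one_div] at h
  exact h

theorem abs_axialProfile_le_one (y : ℝ) : |axialProfile y| ≤ 1 := by
  have := Real.smoothTransition.nonneg (y - 2)
  have := Real.smoothTransition.le_one (y - 2)
  have := Real.smoothTransition.nonneg ((y - 8) / 2)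
  have := Real.smoothTransition.le_one ((y - 8) / 2)
  rw [axialProfile, abs_le]
  constructor <;> linarith

theorem axialProfile_eq_zero {y : ℝ} (hy : y < 2 ∨ 10 < y) : axialProfile y = 0 := by
  rcases hy with hy | hy
  · rw [axialProfile, Real.smoothTransition.zero_of_nonpos (by linarith),
      Real.smoothTransition.zero_of_nonpos (by linarith), sub_zero]
  · rw [axialProfile, Real.smoothTransition.one_of_one_le (by linarith),
      Real.smoothTransition.one_of_one_le (by linarith), sub_self]

theorem deriv_axialProfile_eq_zero {y : ℝ} (hy : y < 2 ∨ (3 < y ∧ y < 8) ∨ 10 < y) :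
    deriv axialProfile y = 0 := by
  rw [deriv_axialProfile]
  rcases hy with hy | hy | hy
  · rw [deriv_smoothTransition_of_lt_zero (by linarith),
      deriv_smoothTransition_of_lt_zero (by linarith)]; simp
  · rw [deriv_smoothTransition_of_one_lt (by linarith),
      deriv_smoothTransition_of_lt_zero (by linarith)]; simp
  · rw [deriv_smoothTransition_of_one_lt (by linarith),
      deriv_smoothTransition_of_one_lt (by linarith)]; simp

theorem deriv_axialProfile_nonneg {y : ℝ} (hy : y < 8) : 0 ≤ deriv axialProfile y := by
  rw [deriv_axialProfile, deriv_smoothTransition_of_lt_zero (y := (y - 8) / 2) (by linarith)]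
  simpa using deriv_smoothTransition_nonneg _

theorem deriv_axialProfile_nonpos {y : ℝ} (hy : 3 < y) : deriv axialProfile y ≤ 0 := by
  rw [deriv_axialProfile, deriv_smoothTransition_of_one_lt (y := y - 2) (by linarith)]
  linarith [deriv_smoothTransition_nonneg ((y - 8) / 2)]

theorem exists_deriv_axialProfile_pos : ∃ y, 0 < deriv axialProfile y := by
  obtain ⟨y, -, h1, hy⟩ := exists_deriv_smoothTransition_pos
  refine ⟨y + 2, ?_⟩
  rw [deriv_axialProfile, deriv_smoothTransition_of_lt_zero (y := (y + 2 - 8) / 2) (by linarith)]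
  simpa using hy

theorem exists_abs_deriv_axialProfile_le : ∃ C, 0 < C ∧ ∀ y, |deriv axialProfile y| ≤ C := by
  have hs : HasCompactSupport (deriv axialProfile) := by
    refine HasCompactSupport.of_support_subset_isCompact (isCompact_Icc (a := 2) (b := 10)) ?_
    intro y hy
    by_contra h
    rw [mem_Icc, not_and_or, not_le, not_le] at h
    exact hy (deriv_axialProfile_eq_zero (h.imp_right Or.inr))
  obtain ⟨C, hC⟩ := hs.exists_bound_of_continuous contDiff_deriv_axialProfile.continuous
  exact ⟨max C 1, by positivity, fun y => (hC y).trans (le_max_left _ _)⟩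

/-- A smooth function agreeing with `q ↦ q ^ (-m / 2)` for `q ≥ 1 / 2` and vanishing for
`q ≤ 1 / 4`. The vector field `x ↦ radialProfile m (|x|²) x` on `ℝ^m` is divergence free for
`|x|² ≥ 1 / 2`. -/
noncomputable def radialProfile (m : ℕ) (q : ℝ) : ℝ :=
  Real.smoothTransition (4 * q - 1) * q ^ (-(m : ℝ) / 2)

/-- The divergence of the vector field `x ↦ radialProfile m (|x|²) x` on `ℝ^m`, as a function of
`|x|²`. -/
noncomputable def radialDensity (m : ℕ) (q : ℝ) : ℝ :=
  m * radialProfile m q + 2 * q * deriv (radialProfile m) q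

variable (m : ℕ)

theorem radialProfile_eq_zero {q : ℝ} (hq : q ≤ 1 / 4) : radialProfile m q = 0 := by
  rw [radialProfile, Real.smoothTransition.zero_of_nonpos (by linarith), zero_mul]

theorem radialProfile_eq_rpow {q : ℝ} (hq : 1 / 2 ≤ q) :
    radialProfile m q = q ^ (-(m : ℝ) / 2) := by
  rw [radialProfile, Real.smoothTransition.one_of_one_le (by linarith), one_mul]

theorem radialProfile_nonneg (q : ℝ) : 0 ≤ radialProfile m q := by
  rcases le_or_gt q (1 / 4) with hq | hq
  · rw [radialProfile_eq_zero m hq]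
  · have : 0 < q := by linarith
    exact mul_nonneg (Real.smoothTransition.nonneg _) (by positivity)

theorem radialProfile_le_rpow {q : ℝ} (hq : 0 < q) : radialProfile m q ≤ q ^ (-(m : ℝ) / 2) :=
  mul_le_of_le_one_left (by positivity) (Real.smoothTransition.le_one _)

theorem contDiff_radialProfile : ContDiff ℝ ∞ (radialProfile m) := by
  rw [contDiff_iff_contDiffAt]
  intro q
  rcases lt_or_ge q (1 / 4) with hq | hq
  · have : radialProfile m =ᶠ[𝓝 q] fun _ => 0 := by
      filter_upwards [Iio_mem_nhds hq] with x hx using radialProfile_eq_zero m (le_of_lt hx)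
    exact contDiffAt_const.congr_of_eventuallyEq this
  · refine ContDiffAt.mul ?_ (Real.contDiffAt_rpow_const_of_ne (by linarith))
    exact (Real.smoothTransition.contDiff.comp
      ((contDiff_const.mul contDiff_id).sub contDiff_const)).contDiffAt

theorem contDiff_radialDensity : ContDiff ℝ ∞ (radialDensity m) :=
  (contDiff_const.mul (contDiff_radialProfile m)).add
    ((contDiff_const.mul contDiff_id).mul (contDiff_infty_iff_deriv.1 (contDiff_radialProfile m)).2)

theorem hasDerivAt_radialProfile (q : ℝ) :
    HasDerivAt (radialProfile m) (deriv (radialProfile m) q) q :=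
  ((contDiff_radialProfile m).differentiable (by simp) q).hasDerivAt

/-- Differentiating the power `q ^ (-m / 2)` cancels the term `m * radialProfile m q`. Only the
derivative of the cutoff survives, which gives both nonnegativity and support in `[1 / 4, 1 / 2]`.
-/
theorem radialDensity_of_pos {q : ℝ} (hq : 0 < q) : radialDensity m q =
    8 * q * deriv Real.smoothTransition (4 * q - 1) * q ^ (-(m : ℝ) / 2) := by
  have h1 := (hasDerivAt_smoothTransition (4 * q - 1)).comp q
    (((hasDerivAt_id q).const_mul 4).sub_const 1)
  have h2 := h1.mul (Real.hasDerivAt_rpow_const (x := q) (p := -(m : ℝ) / 2) (Or.inl hq.ne'))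
  have h3 : deriv (radialProfile m) q = _ := h2.deriv
  rw [radialDensity, h3, radialProfile, Real.rpow_sub_one hq.ne']
  simp only [Function.comp_apply, id]
  field_simp
  ring

theorem radialDensity_of_lt {q : ℝ} (hq : q < 1 / 4) : radialDensity m q = 0 := by
  have : radialProfile m =ᶠ[𝓝 q] fun _ => 0 := by
    filter_upwards [Iio_mem_nhds hq] with x hx using radialProfile_eq_zero m (le_of_lt hx)
  rw [radialDensity, this.deriv_eq, radialProfile_eq_zero m hq.le]
  simp

theorem radialDensity_of_gt {q : ℝ} (hq : 1 / 2 < q) : radialDensity m q = 0 := by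
  rw [radialDensity_of_pos m (by linarith), deriv_smoothTransition_of_one_lt (by linarith)]
  simp

theorem radialDensity_nonneg (q : ℝ) : 0 ≤ radialDensity m q := by
  rcases lt_or_ge q (1 / 4) with hq | hq
  · rw [radialDensity_of_lt m hq]
  · have hq0 : 0 < q := by linarith
    rw [radialDensity_of_pos m hq0]
    have := deriv_smoothTransition_nonneg (4 * q - 1)
    positivity

theorem exists_radialDensity_pos : ∃ q, 0 < q ∧ 0 < radialDensity m q := by
  obtain ⟨y, h0, -, hy⟩ := exists_deriv_smoothTransition_pos
  have hq : 0 < (y + 1) / 4 := by linarith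
  refine ⟨(y + 1) / 4, hq, ?_⟩
  rw [radialDensity_of_pos m hq, show 4 * ((y + 1) / 4) - 1 = y by ring]
  positivity

theorem exists_radialDensity_le : ∃ C, 0 < C ∧ ∀ q, radialDensity m q ≤ C := by
  have hs : HasCompactSupport (radialDensity m) := by
    refine HasCompactSupport.of_support_subset_isCompact (isCompact_Icc (a := 1 / 4) (b := 1 / 2)) ?_
    intro y hy
    by_contra h
    rw [mem_Icc, not_and_or, not_le, not_le] at h
    exact hy (h.elim (radialDensity_of_lt m) (radialDensity_of_gt m))
  obtain ⟨C, hC⟩ := hs.exists_bound_of_continuous (contDiff_radialDensity m).continuous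
  exact ⟨max C 1, by positivity, fun y => ((le_abs_self _).trans (hC y)).trans (le_max_left _ _)⟩

/-- The rescaling of `radialProfile m` to length scale `a`. -/
noncomputable def scaledRadialProfile (a q : ℝ) : ℝ := (a ^ m)⁻¹ * radialProfile m (q / a ^ 2)

theorem scaledRadialProfile_nonneg {a : ℝ} (ha : 0 < a) (q : ℝ) :
    0 ≤ scaledRadialProfile m a q :=
  mul_nonneg (by positivity) (radialProfile_nonneg m _)

theorem inv_pow_mul_div_sq_rpow {a s : ℝ} (ha : 0 < a) (hs : 0 < s) :
    (a ^ m)⁻¹ * (s ^ 2 / a ^ 2) ^ (-(m : ℝ) / 2) = (s ^ m)⁻¹ := by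
  have h : s ^ 2 / a ^ 2 = (s / a) ^ (2 : ℝ) := by rw [Real.rpow_two, div_pow]
  rw [h, ← Real.rpow_mul (by positivity), mul_div_cancel₀ _ two_ne_zero,
    Real.rpow_neg (by positivity), Real.rpow_natCast, div_pow]
  field_simp

theorem scaledRadialProfile_le {a s : ℝ} (ha : 0 < a) (hs : 0 < s) :
    scaledRadialProfile m a (s ^ 2) ≤ (s ^ m)⁻¹ := by
  rw [← inv_pow_mul_div_sq_rpow m ha hs, scaledRadialProfile]
  gcongr
  exact radialProfile_le_rpow m (by positivity)

/-- Outside radius `a` the profile forgets `a`: sources of every scale have the same total flux, so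
differences of two profiles vanish beyond the larger scale. -/
theorem scaledRadialProfile_eq {a s : ℝ} (ha : 0 < a) (hs : a ≤ s) :
    scaledRadialProfile m a (s ^ 2) = (s ^ m)⁻¹ := by
  rw [← inv_pow_mul_div_sq_rpow m ha (ha.trans_le hs), scaledRadialProfile, radialProfile_eq_rpow]
  have : 1 ≤ s ^ 2 / a ^ 2 := by rw [one_le_div (by positivity)]; gcongr
  linarith

theorem scaledRadialProfile_eq_zero {a s : ℝ} (ha : 0 < a) (hs : 0 ≤ s) (h : s ≤ a / 2) :
    scaledRadialProfile m a (s ^ 2) = 0 := by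
  rw [scaledRadialProfile, radialProfile_eq_zero, mul_zero]
  rw [div_le_div_iff₀ (by positivity) (by norm_num)]
  nlinarith

theorem contDiff_scaledRadialProfile (a : ℝ) : ContDiff ℝ ∞ (scaledRadialProfile m a) :=
  contDiff_const.mul ((contDiff_radialProfile m).comp (contDiff_id.div_const _))

theorem hasDerivAt_scaledRadialProfile (a q : ℝ) : HasDerivAt (scaledRadialProfile m a)
    ((a ^ m)⁻¹ * (deriv (radialProfile m) (q / a ^ 2) / a ^ 2)) q := by
  have := ((hasDerivAt_radialProfile m (q / a ^ 2)).comp q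
    ((hasDerivAt_id q).div_const (a ^ 2))).const_mul (a ^ m)⁻¹
  rw [mul_one_div] at this
  exact this

end Profiles

/-! ### The spreading vector field: support, divergence and size. -/

section SpreadingField

theorem contDiff_coord {ι : Type*} [Fintype ι] (i : ι) :
    ContDiff ℝ ∞ fun z : EuclideanSpace ℝ ι => z i :=
  (EuclideanSpace.proj (𝕜 := ℝ) i).contDiff

variable {n : ℕ} [NeZero n]

/-- The components of a smooth compactly supported vector field which flows from the thin
cylinder `s ≤ a` at height `r / 8 ≤ t ≤ 3 r / 16` to the same cylinder at height
`r / 2 ≤ t ≤ 5 r / 8`, spreading over the thick cylinder `s ≤ r / 2` in between. -/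
noncomputable def spreadingField (n : ℕ) [NeZero n] (a r : ℝ) (i : Fin n)
    (z : EuclideanSpace ℝ (Fin n)) : ℝ :=
  if i = 0 then
    axialProfile (16 / r * z 0) * (((r / 2) ^ (n - 1))⁻¹ *
      radialDensity (n - 1) ((∑ j ∈ Finset.univ.erase (0 : Fin n), z j ^ 2) / (r / 2) ^ 2))
  else
    16 / r * deriv axialProfile (16 / r * z 0) * (z i *
      (scaledRadialProfile (n - 1) a (∑ j ∈ Finset.univ.erase (0 : Fin n), z j ^ 2) -
        scaledRadialProfile (n - 1) (r / 2) (∑ j ∈ Finset.univ.erase (0 : Fin n), z j ^ 2)))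

theorem contDiff_transversal_sq :
    ContDiff ℝ ∞ fun z : EuclideanSpace ℝ (Fin n) => ∑ j ∈ Finset.univ.erase (0 : Fin n), z j ^ 2 :=
  ContDiff.sum fun j _ => (contDiff_coord j).pow 2

theorem contDiff_spreadingField (a r : ℝ) (i : Fin n) :
    ContDiff ℝ ∞ (spreadingField n a r i) := by
  unfold spreadingField
  by_cases hi : i = 0
  · simp only [hi, if_true]
    exact (contDiff_axialProfile.comp (contDiff_const.mul (contDiff_coord 0))).mul
      (contDiff_const.mul ((contDiff_radialDensity _).comp (contDiff_transversal_sq.div_const _)))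
  · simp only [hi, if_false]
    exact (contDiff_const.mul (contDiff_deriv_axialProfile.comp
      (contDiff_const.mul (contDiff_coord 0)))).mul ((contDiff_coord i).mul
      (((contDiff_scaledRadialProfile _ _).comp contDiff_transversal_sq).sub
        ((contDiff_scaledRadialProfile _ _).comp contDiff_transversal_sq)))

theorem spreadingField_eq_zero {a r : ℝ} (ha : 0 < a) (har : a ≤ r / 2) (i : Fin n)
    {z : EuclideanSpace ℝ (Fin n)}
    (hz : z 0 < r / 8 ∨ 5 * r / 8 < z 0 ∨ r / 2 < transversalNorm z) :
    spreadingField n a r i z = 0 := by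
  have hr : 0 < r := by linarith
  rw [spreadingField, ← transversalNorm_sq]
  have hlo : z 0 < r / 8 → 16 / r * z 0 < 2 := fun h => by
    rw [div_mul_eq_mul_div, div_lt_iff₀ hr]; linarith
  have hhi : 5 * r / 8 < z 0 → 10 < 16 / r * z 0 := fun h => by
    rw [div_mul_eq_mul_div, lt_div_iff₀ hr]; linarith
  split_ifs with hi
  · rcases hz with h | h | h
    · rw [axialProfile_eq_zero (Or.inl (hlo h)), zero_mul]
    · rw [axialProfile_eq_zero (Or.inr (hhi h)), zero_mul]
    · rw [radialDensity_of_gt, mul_zero, mul_zero]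
      have : 1 ≤ transversalNorm z ^ 2 / (r / 2) ^ 2 := by
        rw [one_le_div (by positivity)]; gcongr
      linarith
  · rcases hz with h | h | h
    · rw [deriv_axialProfile_eq_zero (Or.inl (hlo h))]; ring
    · rw [deriv_axialProfile_eq_zero (Or.inr (Or.inr (hhi h)))]; ring
    · rw [scaledRadialProfile_eq _ ha (har.trans h.le),
        scaledRadialProfile_eq _ (by positivity) h.le]
      ring

theorem support_spreadingField_subset {a r : ℝ} (ha : 0 < a) (har : a ≤ r / 2) (i : Fin n) :
    Function.support (spreadingField n a r i) ⊆ Metric.closedBall 0 (9 / 10 * r) := by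
  have hr : 0 < r := by linarith
  intro z hz
  have h := mt (spreadingField_eq_zero ha har i (z := z)) hz
  push Not at h
  obtain ⟨h1, h2, h3⟩ := h
  rw [mem_closedBall_zero_iff]
  refine abs_le_of_sq_le_sq' ?_ (by positivity) |>.2
  rw [norm_sq_eq_add_transversalNorm_sq]
  -- On the support `|z|² ≤ (25 / 64 + 1 / 4) r²`, below `(9 / 10 * r)²`.
  have := transversalNorm_nonneg z
  nlinarith

theorem tsupport_spreadingField_subset {a r : ℝ} (ha : 0 < a) (har : a ≤ r / 2) (i : Fin n) :
    tsupport (spreadingField n a r i) ⊆ Metric.ball 0 r :=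
  (closure_minimal (support_spreadingField_subset ha har i) Metric.isClosed_closedBall).trans
    (Metric.closedBall_subset_ball (by linarith))

theorem hasCompactSupport_spreadingField {a r : ℝ} (ha : 0 < a) (har : a ≤ r / 2) (i : Fin n) :
    HasCompactSupport (spreadingField n a r i) :=
  HasCompactSupport.of_support_subset_isCompact (isCompact_closedBall _ _)
    (support_spreadingField_subset ha har i)

theorem fderiv_spreadingField_zero (a r : ℝ) (z : EuclideanSpace ℝ (Fin n)) :
    fderiv ℝ (spreadingField n a r 0) z (EuclideanSpace.single 0 1) =
      16 / r * deriv axialProfile (16 / r * z 0) * (((r / 2) ^ (n - 1))⁻¹ *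
        radialDensity (n - 1) ((∑ j ∈ Finset.univ.erase (0 : Fin n), z j ^ 2) / (r / 2) ^ 2)) := by
  have h1 := (((contDiff_spreadingField a r (0 : Fin n)).differentiable (by simp)
    z).hasFDerivAt.hasLineDerivAt (EuclideanSpace.single 0 1))
  have hfun : (fun t : ℝ => spreadingField n a r 0 (z + t • EuclideanSpace.single 0 1)) = fun t =>
      axialProfile (16 / r * (z 0 + t)) * (((r / 2) ^ (n - 1))⁻¹ *
        radialDensity (n - 1) ((∑ j ∈ Finset.univ.erase (0 : Fin n), z j ^ 2) / (r / 2) ^ 2)) := by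
    ext t
    have hsum : ∑ j ∈ Finset.univ.erase (0 : Fin n),
        (z + t • EuclideanSpace.single (0 : Fin n) (1 : ℝ)) j ^ 2 =
        ∑ j ∈ Finset.univ.erase (0 : Fin n), z j ^ 2 :=
      Finset.sum_congr rfl fun j hj => by simp [Finset.ne_of_mem_erase hj]
    rw [spreadingField, if_pos rfl, hsum]
    simp
  have hA : HasDerivAt axialProfile (deriv axialProfile (16 / r * (z 0 + 0)))
      (16 / r * (z 0 + 0)) := (contDiff_axialProfile.differentiable (by simp) _).hasDerivAt
  have h2 := (hA.comp 0 (((hasDerivAt_id (0 : ℝ)).const_add (z 0)).const_mul (16 / r))).mul_const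
    (((r / 2) ^ (n - 1))⁻¹ *
        radialDensity (n - 1) ((∑ j ∈ Finset.univ.erase (0 : Fin n), z j ^ 2) / (r / 2) ^ 2))
  rw [HasLineDerivAt, hfun] at h1
  rw [h1.unique h2, add_zero]
  ring

theorem fderiv_spreadingField_of_ne (a r : ℝ) {i : Fin n} (hi : i ≠ 0)
    (z : EuclideanSpace ℝ (Fin n)) {q : ℝ} (hq : ∑ j ∈ Finset.univ.erase (0 : Fin n), z j ^ 2 = q) :
    fderiv ℝ (spreadingField n a r i) z (EuclideanSpace.single i 1) =
      16 / r * deriv axialProfile (16 / r * z 0) *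
        ((scaledRadialProfile (n - 1) a q - scaledRadialProfile (n - 1) (r / 2) q) +
        2 * z i ^ 2 * ((a ^ (n - 1))⁻¹ * (deriv (radialProfile (n - 1)) (q / a ^ 2) / a ^ 2) -
          ((r / 2) ^ (n - 1))⁻¹ *
            (deriv (radialProfile (n - 1)) (q / (r / 2) ^ 2) / (r / 2) ^ 2))) := by
  have h1 := (((contDiff_spreadingField a r i).differentiable (by simp)
    z).hasFDerivAt.hasLineDerivAt (EuclideanSpace.single i 1))
  have hsum : ∀ t : ℝ, ∑ j ∈ Finset.univ.erase (0 : Fin n),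
      (z + t • EuclideanSpace.single i (1 : ℝ)) j ^ 2 = q + (2 * z i * t + t ^ 2) := by
    intro t
    have hmem : i ∈ Finset.univ.erase (0 : Fin n) := Finset.mem_erase.2 ⟨hi, Finset.mem_univ _⟩
    rw [← hq, ← Finset.add_sum_erase _ _ hmem,
      ← Finset.add_sum_erase (Finset.univ.erase (0 : Fin n)) (fun j => z j ^ 2) hmem,
      Finset.sum_congr rfl (g := fun j => z j ^ 2)]
    · simp; ring
    · intro j hj
      simp [Finset.ne_of_mem_erase hj]
  have hfun : (fun t : ℝ => spreadingField n a r i (z + t • EuclideanSpace.single i 1)) = fun t =>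
      16 / r * deriv axialProfile (16 / r * z 0) * ((z i + t) *
      (scaledRadialProfile (n - 1) a (q + (2 * z i * t + t ^ 2)) -
        scaledRadialProfile (n - 1) (r / 2) (q + (2 * z i * t + t ^ 2)))) := by
    ext t
    rw [spreadingField, if_neg hi, hsum t]
    simp [hi.symm]
  have hinner : HasDerivAt (fun t : ℝ => q + (2 * z i * t + t ^ 2)) (2 * z i) 0 := by
    have := (((hasDerivAt_id (0 : ℝ)).const_mul (2 * z i)).add
      ((hasDerivAt_id (0 : ℝ)).pow 2)).const_add q
    exact this.congr_deriv (by simp)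
  have hs : ∀ b, HasDerivAt (fun t : ℝ => scaledRadialProfile (n - 1) b (q + (2 * z i * t + t ^ 2)))
      ((b ^ (n - 1))⁻¹ * (deriv (radialProfile (n - 1)) (q / b ^ 2) / b ^ 2) * (2 * z i)) 0 := by
    intro b
    refine HasDerivAt.comp (h₂ := scaledRadialProfile (n - 1) b) 0 ?_ hinner
    have := hasDerivAt_scaledRadialProfile (n - 1) b q
    simpa using this
  have h2 := ((((hasDerivAt_id (0 : ℝ)).const_add (z i)).mul ((hs a).sub (hs (r / 2)))).const_mul
    (16 / r * deriv axialProfile (16 / r * z 0)))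
  rw [HasLineDerivAt, hfun] at h1
  rw [h1.unique h2]
  simp only [id, Pi.sub_apply, mul_zero, add_zero, zero_pow two_ne_zero]
  ring

/-- Write `ρ_b` for the radial density rescaled to length `b`. The axial component contributes
`ρ_{r/2}`, the transversal ones `ρ_a - ρ_{r/2}`, with the same axial factor. The wide density
cancels, leaving divergence only near the thin cylinder. -/
theorem divergence_spreadingField {a r : ℝ} (ha : 0 < a) (hr : 0 < r)
    (z : EuclideanSpace ℝ (Fin n)) :
    ∑ i, fderiv ℝ (spreadingField n a r i) z (EuclideanSpace.single i 1) =
      16 / r * deriv axialProfile (16 / r * z 0) * ((a ^ (n - 1))⁻¹ *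
        radialDensity (n - 1) ((∑ j ∈ Finset.univ.erase (0 : Fin n), z j ^ 2) / a ^ 2)) := by
  set q := ∑ j ∈ Finset.univ.erase (0 : Fin n), z j ^ 2 with hq
  rw [← Finset.add_sum_erase _ _ (Finset.mem_univ (0 : Fin n)), fderiv_spreadingField_zero,
    Finset.sum_congr rfl fun i hi =>
      fderiv_spreadingField_of_ne a r (Finset.ne_of_mem_erase hi) z hq.symm,
    ← Finset.mul_sum, Finset.sum_add_distrib, ← Finset.sum_mul, ← Finset.mul_sum, ← hq,
    Finset.sum_const, Finset.card_erase_of_mem (Finset.mem_univ _), Finset.card_univ,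
    Fintype.card_fin, nsmul_eq_mul, radialDensity, radialDensity, scaledRadialProfile,
    scaledRadialProfile]
  field_simp
  ring

theorem exists_abs_spreadingField_le (hn : 2 ≤ n) : ∃ C, 0 < C ∧ ∀ a r : ℝ, 0 < a → a ≤ r / 2 →
    ∀ (i : Fin n) (z : EuclideanSpace ℝ (Fin n)),
      |spreadingField n a r i z| ≤ C / r * (max a (transversalNorm z) ^ (n - 2))⁻¹ := by
  obtain ⟨C₁, hC₁, h₁⟩ := exists_abs_deriv_axialProfile_le
  obtain ⟨C₂, hC₂, h₂⟩ := exists_radialDensity_le (n - 1)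
  have hn1 : n - 1 = n - 2 + 1 := by omega
  refine ⟨max (2 * C₂) (16 * C₁ * 2 ^ (n - 2)), by positivity, fun a r ha har i z => ?_⟩
  have hr : 0 < r := by linarith
  set s := transversalNorm z with hs_def
  have hs := transversalNorm_nonneg z
  rcases lt_or_ge (r / 2) s with hsr | hsr
  · rw [spreadingField_eq_zero ha har i (Or.inr (Or.inr hsr)), abs_zero]
    positivity
  have hM : 0 < max a s := lt_max_of_lt_left ha
  have hMr : max a s ≤ r / 2 := max_le har hsr
  rw [spreadingField, ← transversalNorm_sq, ← hs_def]
  split_ifs with hi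
  · have hd := radialDensity_nonneg (n - 1) (s ^ 2 / (r / 2) ^ 2)
    rw [abs_mul, abs_of_nonneg (a := _ * radialDensity _ _) (by positivity)]
    calc _ ≤ 1 * (((r / 2) ^ (n - 1))⁻¹ * C₂) := by
          gcongr
          · exact abs_axialProfile_le_one _
          · exact h₂ _
      _ = 2 * C₂ / r * ((r / 2) ^ (n - 2))⁻¹ := by rw [hn1, pow_succ]; field_simp
      _ ≤ _ := by gcongr; exact le_max_left _ _
  · rw [abs_mul, abs_mul, abs_of_pos (a := 16 / r) (by positivity), abs_mul]
    have hzi := abs_coord_le_transversalNorm z hi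
    rw [← hs_def] at hzi
    have key : |z i| * |scaledRadialProfile (n - 1) a (s ^ 2) -
        scaledRadialProfile (n - 1) (r / 2) (s ^ 2)| ≤ 2 ^ (n - 2) * (max a s ^ (n - 2))⁻¹ := by
      -- Both profiles vanish for `s ≤ a / 2`. Otherwise `max a s ≤ 2 * s`, so the decay `s * s ^
      -- (-(n - 1))` controls the field down to scale `a`.
      rcases le_or_gt s (a / 2) with hsa | hsa
      · rw [scaledRadialProfile_eq_zero _ ha hs hsa,
          scaledRadialProfile_eq_zero _ (by positivity) hs (by linarith), sub_zero, abs_zero,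
          mul_zero]
        positivity
      · have hs0 : 0 < s := by linarith
        have hMs : max a s ≤ 2 * s := max_le (by linarith) (by linarith)
        calc _ ≤ s * (s ^ (n - 1))⁻¹ := by
              gcongr
              have e1 := scaledRadialProfile_le (n - 1) ha hs0
              have e2 := scaledRadialProfile_le (n - 1) (show 0 < r / 2 by positivity) hs0
              have e3 := scaledRadialProfile_nonneg (n - 1) ha (s ^ 2)
              have e4 := scaledRadialProfile_nonneg (n - 1) (show 0 < r / 2 by positivity) (s ^ 2)
              rw [abs_le]
              constructor <;> linarith
          _ = 2 ^ (n - 2) * ((2 * s) ^ (n - 2))⁻¹ := by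
              rw [hn1, pow_succ, mul_pow]; field_simp
          _ ≤ _ := by gcongr
    calc _ ≤ 16 / r * C₁ * (2 ^ (n - 2) * (max a s ^ (n - 2))⁻¹) := by
          gcongr
          exact h₁ _
      _ = 16 * C₁ * 2 ^ (n - 2) / r * (max a s ^ (n - 2))⁻¹ := by ring
      _ ≤ _ := by gcongr; exact le_max_right _ _

end SpreadingField

/-! ### Testing the weak gradient against the spreading field. -/

section Duality

variable {n : ℕ} [NeZero n]

/-- The linear map scaling the axis by `16 / r` and the other coordinates by `1 / a` has determinant
equal to the prefactor, so the integral does not depend on `a` or `r`. This is the mass of the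
positive part of the divergence. -/
theorem exists_integral_scaled_eq (hn : 2 ≤ n) : ∃ c : ℝ, 0 < c ∧ ∀ a r : ℝ, 0 < a → 0 < r →
    ∫ z : EuclideanSpace ℝ (Fin n), 16 / r * max (deriv axialProfile (16 / r * z 0)) 0 *
      ((a ^ (n - 1))⁻¹ * radialDensity (n - 1)
        ((∑ j ∈ Finset.univ.erase (0 : Fin n), z j ^ 2) / a ^ 2)) = c := by
  set F : (Fin n → ℝ) → ℝ := fun y => max (deriv axialProfile (y 0)) 0 *
    radialDensity (n - 1) (∑ j ∈ Finset.univ.erase (0 : Fin n), y j ^ 2) with hF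
  have hdA := contDiff_deriv_axialProfile.continuous
  have hdR := (contDiff_radialDensity (n - 1)).continuous
  have hFc : Continuous F := by
    simp only [hF]
    fun_prop
  refine ⟨∫ y, F y, ?_, fun a r ha hr => ?_⟩
  · obtain ⟨y, hy⟩ := exists_deriv_axialProfile_pos
    obtain ⟨q, hq0, hq⟩ := exists_radialDensity_pos (n - 1)
    have hsupp : HasCompactSupport F := by
      refine HasCompactSupport.of_support_subset_isCompact
        (isCompact_Icc (a := fun _ : Fin n => (-10 : ℝ)) (b := fun _ => 10)) ?_
      intro z hz
      have h0 : 2 ≤ z 0 ∧ z 0 ≤ 10 := by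
        by_contra h
        rw [not_and_or, not_le, not_le] at h
        refine hz ?_
        simp only [hF]
        rw [deriv_axialProfile_eq_zero (h.imp_right Or.inr), max_self, zero_mul]
      have h1 : ∑ j ∈ Finset.univ.erase (0 : Fin n), z j ^ 2 ≤ 1 / 2 := by
        by_contra h
        refine hz ?_
        simp only [hF]
        rw [radialDensity_of_gt _ (not_le.1 h), mul_zero]
      have h2 : ∀ i, |z i| ≤ 10 := fun i => by
        by_cases hi : i = 0
        · rw [hi, abs_le]; constructor <;> linarith
        · have := Finset.single_le_sum (f := fun i => z i ^ 2) (fun _ _ => sq_nonneg _)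
            (Finset.mem_erase.2 ⟨hi, Finset.mem_univ _⟩)
          refine abs_le_of_sq_le_sq ?_ (by norm_num)
          linarith
      exact ⟨fun i => (abs_le.1 (h2 i)).1, fun i => (abs_le.1 (h2 i)).2⟩
    obtain ⟨i₁, hi₁⟩ : ∃ i : Fin n, i ≠ 0 := by
      have : Nontrivial (Fin n) := Fin.nontrivial_iff_two_le.2 hn
      exact exists_ne 0
    refine hFc.integral_pos_of_hasCompactSupport_nonneg_nonzero hsupp
      (fun z => mul_nonneg (le_max_right _ _) (radialDensity_nonneg _ _))
      -- A point with axial coordinate `y` and squared transversal norm `q`, where both factors of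
      -- `F` are positive; `2 ≤ n` supplies the coordinate `i₁`.
      (x := fun i => if i = 0 then y else if i = i₁ then Real.sqrt q else 0) (ne_of_gt ?_)
    have hsum : ∑ j ∈ Finset.univ.erase (0 : Fin n),
        (if j = 0 then y else if j = i₁ then Real.sqrt q else 0) ^ 2 = q := by
      rw [Finset.sum_eq_single_of_mem i₁ (Finset.mem_erase.2 ⟨hi₁, Finset.mem_univ _⟩)]
      · rw [if_neg hi₁, if_pos rfl, Real.sq_sqrt hq0.le]
      · intro j hj hj1
        rw [if_neg (Finset.ne_of_mem_erase hj), if_neg hj1, zero_pow two_ne_zero]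
    simp only [hF]
    simp only [hsum, if_true]
    exact mul_pos (lt_max_of_lt_left hy) hq
  · set D : Fin n → ℝ := fun i => if i = 0 then 16 / r else 1 / a with hD
    have hdet : (Matrix.diagonal D).det = 16 / r * (a ^ (n - 1))⁻¹ := by
      rw [Matrix.det_diagonal, ← Finset.mul_prod_erase _ _ (Finset.mem_univ (0 : Fin n)),
        Finset.prod_congr rfl (g := fun _ => 1 / a), Finset.prod_const,
        Finset.card_erase_of_mem (Finset.mem_univ _), Finset.card_univ, Fintype.card_fin]
      · simp [hD]
      · intro i hi
        simp [hD, Finset.ne_of_mem_erase hi]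
    have hpos : 0 < (Matrix.diagonal D).det := by rw [hdet]; positivity
    have hmap := Real.smul_map_diagonal_volume_pi hpos.ne'
    have hcont : Continuous (Matrix.toLin' (Matrix.diagonal D)) :=
      LinearMap.continuous_of_finiteDimensional _
    rw [← hmap, integral_smul_measure, integral_map hcont.aemeasurable hFc.aestronglyMeasurable,
      ← (PiLp.volume_preserving_ofLp (Fin n)).integral_comp
        (MeasurableEquiv.toLp 2 (Fin n → ℝ)).symm.measurableEmbedding,
      ENNReal.toReal_ofReal (abs_nonneg _), abs_of_pos hpos, ← integral_smul]
    refine integral_congr_ae (Eventually.of_forall fun z => ?_)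
    simp only [hF, Matrix.toLin'_apply, Matrix.mulVec_diagonal, smul_eq_mul]
    rw [hdet, Finset.sum_div, Finset.sum_congr rfl (g := fun j => (D j * z j) ^ 2)]
    · simp only [hD, if_true]; ring
    · intro j hj
      simp only [hD, if_neg (Finset.ne_of_mem_erase hj)]
      field_simp

/-- The product of `u` with the divergence dominates the positive part of the divergence, whose
integral is a fixed constant. Integrating by parts moves the derivative to `g`, and the field is
bounded by `C / r` times the weight. -/
theorem exists_le_mul_lintegral_gradient (hn : 2 ≤ n) : ∃ c : ℝ, 0 < c ∧ ∀ {p a r : ℝ}, 1 ≤ p →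
    0 < a → a ≤ r / 2 → ∀ {u : EuclideanSpace ℝ (Fin n) → ℝ}
    {g : EuclideanSpace ℝ (Fin n) → EuclideanSpace ℝ (Fin n)},
    IsSobolevPair p (Metric.ball 0 r) u g →
    (∀ z : EuclideanSpace ℝ (Fin n), r / 8 ≤ z 0 → z 0 ≤ 3 * r / 16 → transversalNorm z < a →
      1 ≤ u z) →
    (∀ z : EuclideanSpace ℝ (Fin n), r / 2 ≤ z 0 → z 0 ≤ 5 * r / 8 → transversalNorm z < a →
      u z ≤ 0) →
    ENNReal.ofReal (c * r) ≤ ∫⁻ z in Metric.ball (0 : EuclideanSpace ℝ (Fin n)) r,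
      ‖g z‖ₑ * ENNReal.ofReal ((max a (transversalNorm z) ^ (n - 2))⁻¹) := by
  obtain ⟨c, hc, hint⟩ := exists_integral_scaled_eq hn
  obtain ⟨C, hC, hbound⟩ := exists_abs_spreadingField_le hn
  have hn0 : 0 < n := by omega
  refine ⟨c / (n * C), by positivity, ?_⟩
  intro p a r hp ha har u g hug hu1 hu0
  have hr : 0 < r := by linarith
  set B := Metric.ball (0 : EuclideanSpace ℝ (Fin n)) r with hB
  have : IsFiniteMeasure (volume.restrict B) := ⟨by simpa [hB] using measure_ball_lt_top⟩
  have hu_int : Integrable u (volume.restrict B) :=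
    hug.memLp_fun.integrable (by rwa [ENNReal.one_le_ofReal])
  have hterm : ∀ i : Fin n, Integrable (fun z =>
      u z * fderiv ℝ (spreadingField n a r i) z (EuclideanSpace.single i 1))
      (volume.restrict B) := by
    intro i
    have hcont : Continuous fun z =>
        fderiv ℝ (spreadingField n a r i) z (EuclideanSpace.single i 1) :=
      ((contDiff_spreadingField a r i).continuous_fderiv (by simp)).clm_apply continuous_const
    have hcs : HasCompactSupport fun z =>
        fderiv ℝ (spreadingField n a r i) z (EuclideanSpace.single i 1) :=
      (hasCompactSupport_spreadingField ha har i).fderiv_apply ℝ _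
    obtain ⟨K, hK⟩ := hcs.exists_bound_of_continuous hcont
    exact hu_int.mul_bdd hcont.aestronglyMeasurable (Eventually.of_forall hK)
  set D : EuclideanSpace ℝ (Fin n) → ℝ := fun z =>
    16 / r * max (deriv axialProfile (16 / r * z 0)) 0 * ((a ^ (n - 1))⁻¹ * radialDensity (n - 1)
      ((∑ j ∈ Finset.univ.erase (0 : Fin n), z j ^ 2) / a ^ 2)) with hD
  have hDnn : ∀ z, 0 ≤ D z := fun z => by
    have := radialDensity_nonneg (n - 1) ((∑ j ∈ Finset.univ.erase (0 : Fin n), z j ^ 2) / a ^ 2)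
    have := le_max_right (deriv axialProfile (16 / r * z 0)) 0
    positivity
  have hDle : ∀ z, D z ≤
      ∑ i, u z * fderiv ℝ (spreadingField n a r i) z (EuclideanSpace.single i 1) := by
    intro z
    rw [← Finset.mul_sum, divergence_spreadingField ha hr]
    simp only [hD]
    rw [← transversalNorm_sq]
    set y := 16 / r * z 0 with hy
    have hz0 : z 0 = y * r / 16 := by rw [hy]; field_simp
    set f := radialDensity (n - 1) (transversalNorm z ^ 2 / a ^ 2) with hf
    have hfn : 0 ≤ f := radialDensity_nonneg _ _
    rcases hfn.eq_or_lt with h0 | h0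
    · rw [← h0]; simp
    have hsa : transversalNorm z < a := by
      by_contra! h
      have : 1 ≤ transversalNorm z ^ 2 / a ^ 2 := by rw [one_le_div (by positivity)]; gcongr
      rw [hf, radialDensity_of_gt _ (by linarith)] at h0
      exact lt_irrefl _ h0
    -- The values `y = 2, 3, 8, 10` correspond to heights `r / 8`, `3 * r / 16`, `r / 2`, `5 * r /
    -- 8`. On the lower slab the derivative is nonnegative and `u ≥ 1`; on the upper one it is
    -- nonpositive and `u ≤ 0`.
    have hmain : max (deriv axialProfile y) 0 ≤ u z * deriv axialProfile y := by
      by_cases h1 : y < 2 ∨ (3 < y ∧ y < 8) ∨ 10 < y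
      · rw [deriv_axialProfile_eq_zero h1]; simp
      push Not at h1
      rcases le_or_gt y 3 with h3 | h3
      · have hd := deriv_axialProfile_nonneg (show y < 8 by linarith)
        rw [max_eq_left hd]
        refine le_mul_of_one_le_left hd (hu1 z ?_ ?_ hsa) <;> rw [hz0]
        · nlinarith [h1.1]
        · nlinarith
      · have hd := deriv_axialProfile_nonpos h3
        rw [max_eq_right hd]
        refine mul_nonneg_of_nonpos_of_nonpos (hu0 z ?_ ?_ hsa) hd <;> rw [hz0]
        · nlinarith [h1.2.1 h3]
        · nlinarith [h1.2.2]
    calc _ ≤ 16 / r * (u z * deriv axialProfile y) * ((a ^ (n - 1))⁻¹ * f) := by gcongr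
      _ = _ := by ring
  have hDout : ∀ z, z ∉ B → D z = 0 := by
    intro z hz
    have h0 : ∀ i, fderiv ℝ (spreadingField n a r i) z = 0 := fun i => by
      by_contra h
      exact hz (tsupport_spreadingField_subset ha har i (support_fderiv_subset ℝ h))
    refine le_antisymm ((hDle z).trans_eq ?_) (hDnn z)
    simp [h0]
  have hDcont : Continuous D := by
    have := contDiff_deriv_axialProfile.continuous
    have := (contDiff_radialDensity (n - 1)).continuous
    simp only [hD]
    fun_prop
  have hsum_int := integrable_finsetSum Finset.univ fun i (_ : i ∈ Finset.univ) => hterm i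
  have hD_int : Integrable D (volume.restrict B) := by
    refine hsum_int.mono' hDcont.aestronglyMeasurable (Eventually.of_forall fun z => ?_)
    rw [Real.norm_of_nonneg (hDnn z)]
    exact hDle z
  have h1 : c ≤ -∑ i, ∫ z in B, inner ℝ (g z) (EuclideanSpace.single i 1) *
      spreadingField n a r i z := by
    rw [← hint a r ha hr, ← setIntegral_eq_integral_of_forall_compl_eq_zero (s := B) hDout,
      ← Finset.sum_neg_distrib]
    refine (integral_mono hD_int hsum_int hDle).trans (le_of_eq ?_)
    rw [integral_finsetSum _ fun i _ => hterm i]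
    exact Finset.sum_congr rfl fun i _ => hug.weakGradient _ (contDiff_spreadingField a r i)
      (hasCompactSupport_spreadingField ha har i) (tsupport_spreadingField_subset ha har i) _
  set I := ∫⁻ z in B, ‖g z‖ₑ * ENNReal.ofReal ((max a (transversalNorm z) ^ (n - 2))⁻¹)
  have h2 : ∀ i : Fin n, ‖∫ z in B, inner ℝ (g z) (EuclideanSpace.single i 1) *
      spreadingField n a r i z‖ₑ ≤ ENNReal.ofReal (C / r) * I := by
    intro i
    refine (enorm_integral_le_lintegral_enorm _).trans ?_
    rw [← lintegral_const_mul' _ _ ENNReal.ofReal_ne_top]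
    refine lintegral_mono fun z => ?_
    rw [enorm_mul, mul_left_comm]
    refine mul_le_mul' ?_ ?_
    · rw [← ofReal_norm, ← ofReal_norm]
      refine ENNReal.ofReal_le_ofReal ?_
      simpa using norm_inner_le_norm (𝕜 := ℝ) (g z) (EuclideanSpace.single i (1 : ℝ))
    · rw [← ENNReal.ofReal_mul (by positivity), ← ofReal_norm]
      exact ENNReal.ofReal_le_ofReal (hbound a r ha har i z)
  have h3 : ENNReal.ofReal c ≤ ENNReal.ofReal (n * C / r) * I := by
    calc ENNReal.ofReal c ≤ _ := (ENNReal.ofReal_le_ofReal h1).trans (Real.ofReal_le_enorm _)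
      _ ≤ ∑ i : Fin n, ENNReal.ofReal (C / r) * I := by
          rw [enorm_neg]
          exact (enorm_sum_le _ _).trans (Finset.sum_le_sum fun i _ => h2 i)
      _ = _ := by
          rw [Finset.sum_const, Finset.card_univ, Fintype.card_fin, nsmul_eq_mul, ← mul_assoc,
            mul_div_assoc, ENNReal.ofReal_mul (by positivity), ENNReal.ofReal_natCast]
  have h4 : c / (n * C) * r = (n * C / r)⁻¹ * c := by field_simp
  rw [h4, ENNReal.ofReal_mul (by positivity), ENNReal.ofReal_inv_of_pos (by positivity)]
  refine ENNReal.inv_mul_le_iff ?_ ENNReal.ofReal_ne_top |>.2 h3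
  exact (ENNReal.ofReal_pos.2 (by positivity)).ne'

end Duality

/-! ### Lower bounds for capacities of sets containing thin cylinders. -/

section LowerBounds

variable {n : ℕ} [NeZero n]

theorem varCapacity_mono_right {n : ℕ} {p : ℝ} {E F₁ F₂ Ω : Set (EuclideanSpace ℝ (Fin n))}
    (h : F₁ ⊆ F₂) : varCapacity p E F₁ Ω ≤ varCapacity p E F₂ Ω := by
  refine le_iInf fun u => le_iInf fun g => le_iInf fun hu => ?_
  exact iInf_le_of_le u (iInf_le_of_le g (iInf_le_of_le ⟨hu.sobolev,
    hu.continuousOn.mono (union_subset_union_right _ h), hu.one_le,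
    fun x hx => hu.le_zero x (h hx)⟩ le_rfl))

/-- For `p = 1` the conjugate exponent is infinite, so the weight is estimated by its supremum `a ^
(-(n - 2))`. -/
theorem exists_le_varCapacity_one (hn : 2 ≤ n) : ∃ c : ℝ, 0 < c ∧ ∀ {a r : ℝ}, 0 < a → a ≤ r / 2 →
    ∀ {E F : Set (EuclideanSpace ℝ (Fin n))},
    (∀ z : EuclideanSpace ℝ (Fin n), r / 8 ≤ z 0 → z 0 ≤ 3 * r / 16 → transversalNorm z < a →
      z ∈ E) →
    (∀ z : EuclideanSpace ℝ (Fin n), r / 2 ≤ z 0 → z 0 ≤ 5 * r / 8 → transversalNorm z < a →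
      z ∈ F) →
    ENNReal.ofReal (c * (r * a ^ (n - 2))) ≤ varCapacity 1 E F (Metric.ball 0 r) := by
  obtain ⟨c, hc, h⟩ := exists_le_mul_lintegral_gradient hn
  refine ⟨c, hc, fun {a r} ha har {E F} hE hF => ?_⟩
  have hr : 0 < r := by linarith
  refine le_iInf fun u => le_iInf fun g => le_iInf fun hu => ?_
  have h1 := h le_rfl ha har hu.sobolev (fun z h1 h2 h3 => hu.one_le z (hE z h1 h2 h3))
    (fun z h1 h2 h3 => hu.le_zero z (hF z h1 h2 h3))
  have h2 : ENNReal.ofReal (c * r) ≤ (∫⁻ z in Metric.ball 0 r, ‖g z‖ₑ ^ (1 : ℝ)) *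
      ENNReal.ofReal ((a ^ (n - 2))⁻¹) := by
    refine h1.trans ?_
    rw [← lintegral_mul_const' _ _ ENNReal.ofReal_ne_top]
    refine lintegral_mono fun z => ?_
    rw [ENNReal.rpow_one]
    gcongr
    exact le_max_left _ _
  rw [ENNReal.ofReal_inv_of_pos (by positivity), ← div_eq_mul_inv, ENNReal.le_div_iff_mul_le
    (Or.inl (ENNReal.ofReal_pos.2 (by positivity)).ne') (Or.inl ENNReal.ofReal_ne_top),
    ← ENNReal.ofReal_mul (by positivity)] at h2
  rwa [← mul_assoc]

/-- Hölder in the duality estimate gives `(c r) ^ p ≤ I * J ^ (p - 1)`, with `I` the energy and `J ≤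
2 ^ n * r * B` by the layer-cake bound. The free parameter `B` lets each range of `p` choose its own
estimate of the radial integral. -/
theorem exists_le_varCapacity (hn : 3 ≤ n) {p : ℝ} (hp : 1 < p) : ∃ c : ℝ, 0 < c ∧
    ∀ {a r : ℝ}, 0 < a → a ≤ r / 2 → ∀ {E F : Set (EuclideanSpace ℝ (Fin n))},
    (∀ z : EuclideanSpace ℝ (Fin n), r / 8 ≤ z 0 → z 0 ≤ 3 * r / 16 → transversalNorm z < a →
      z ∈ E) →
    (∀ z : EuclideanSpace ℝ (Fin n), r / 2 ≤ z 0 → z 0 ≤ 5 * r / 8 → transversalNorm z < a →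
      z ∈ F) →
    ∀ {B : ℝ}, 0 < B → (r ^ ((n : ℝ) - 1 - ((n : ℝ) - 2) * p / (p - 1)) +
      ((n : ℝ) - 2) * p / (p - 1) *
        ∫ τ in a..r, τ ^ ((n : ℝ) - 1 - ((n : ℝ) - 2) * p / (p - 1) - 1)) ≤ B →
    ENNReal.ofReal (c * (r * B ^ (1 - p))) ≤ varCapacity p E F (Metric.ball 0 r) := by
  obtain ⟨c, hc, h⟩ := exists_le_mul_lintegral_gradient (n := n) (by omega)
  refine ⟨c ^ p * ((2 : ℝ) ^ n) ^ (1 - p), by positivity,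
    fun {a r} ha har {E F} hE hF {B} hB0 hB => ?_⟩
  have hr : 0 < r := by linarith
  have hn2 : (0 : ℝ) < (n : ℝ) - 2 := by
    have : (3 : ℝ) ≤ n := by exact_mod_cast hn
    linarith
  set β := ((n : ℝ) - 2) * p / (p - 1) with hβ
  have hp1 : 0 < p - 1 := by linarith
  have hβ0 : 0 < β := by positivity
  refine le_iInf fun u => le_iInf fun g => le_iInf fun hu => ?_
  have h1 := h hp.le ha har hu.sobolev (fun z h1 h2 h3 => hu.one_le z (hE z h1 h2 h3))
    (fun z h1 h2 h3 => hu.le_zero z (hF z h1 h2 h3))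
  set I := ∫⁻ z in Metric.ball 0 r, ‖g z‖ₑ ^ p with hI
  have hconj : p.HolderConjugate (p / (p - 1)) := Real.HolderConjugate.conjExponent hp
  have hH := ENNReal.lintegral_mul_le_Lp_mul_Lq
    (volume.restrict (Metric.ball (0 : EuclideanSpace ℝ (Fin n)) r)) hconj
    (f := fun z => ‖g z‖ₑ)
    (g := fun z => ENNReal.ofReal ((max a (transversalNorm z) ^ (n - 2))⁻¹))
    hu.sobolev.memLp_grad.aestronglyMeasurable.enorm (by
      have : Measurable (transversalNorm : EuclideanSpace ℝ (Fin n) → ℝ) :=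
        continuous_transversalNorm.measurable
      fun_prop)
  have hJ : ∫⁻ z in Metric.ball (0 : EuclideanSpace ℝ (Fin n)) r,
      ENNReal.ofReal ((max a (transversalNorm z) ^ (n - 2))⁻¹) ^ (p / (p - 1)) ≤
      ENNReal.ofReal (2 ^ n * r * B) := by
    have hpt : ∀ z : EuclideanSpace ℝ (Fin n),
        ENNReal.ofReal ((max a (transversalNorm z) ^ (n - 2))⁻¹) ^ (p / (p - 1)) =
        ENNReal.ofReal (max a (transversalNorm z) ^ (-β)) := by
      intro z
      have hM : 0 < max a (transversalNorm z) := lt_max_of_lt_left ha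
      rw [ENNReal.ofReal_rpow_of_nonneg (by positivity) (by positivity), ← Real.rpow_natCast,
        ← Real.rpow_neg hM.le, ← Real.rpow_mul hM.le, hβ, Nat.cast_sub (by omega)]
      congr 2
      push_cast
      ring
    simp_rw [hpt]
    refine (lintegral_mono_set (ball_subset_solidCylinder r)).trans ?_
    refine (lintegral_max_transversalNorm_rpow_neg_le ha (by linarith) hβ0).trans ?_
    rw [Nat.cast_sub (by omega), Nat.cast_one]
    gcongr
  have h2 : ENNReal.ofReal (c * r) ≤
      I ^ (1 / p) * ENNReal.ofReal (2 ^ n * r * B) ^ (1 / (p / (p - 1))) := by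
    refine (h1.trans hH).trans ?_
    gcongr
  have h3 := ENNReal.rpow_le_rpow h2 (show 0 ≤ p by linarith)
  rw [ENNReal.mul_rpow_of_nonneg _ _ (by linarith), ← ENNReal.rpow_mul, ← ENNReal.rpow_mul,
    one_div_mul_cancel (by linarith), ENNReal.rpow_one,
    show 1 / (p / (p - 1)) * p = p - 1 by field_simp,
    ENNReal.ofReal_rpow_of_nonneg (by positivity) (by linarith),
    ENNReal.ofReal_rpow_of_nonneg (by positivity) (by linarith),
    ← ENNReal.div_le_iff_le_mul (Or.inl (ENNReal.ofReal_pos.2 (by positivity)).ne')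
      (Or.inl ENNReal.ofReal_ne_top), ← ENNReal.ofReal_div_of_pos (by positivity)] at h3
  refine le_trans (ENNReal.ofReal_le_ofReal (le_of_eq ?_)) h3
  have e1 : (2 ^ n * r * B) ^ (p - 1) = (2 ^ n * r * B) ^ (-(1 - p)) := by congr 1; ring
  rw [e1, Real.rpow_neg (by positivity), div_inv_eq_mul, Real.mul_rpow (by positivity) hB0.le,
    Real.mul_rpow (by positivity) hr.le, Real.mul_rpow (x := 2 ^ n) (by positivity) hr.le]
  have e2 : r ^ p * r ^ (1 - p) = r := by
    rw [← Real.rpow_add hr]; simp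
  linear_combination (-(c ^ p * (2 ^ n) ^ (1 - p) * B ^ (1 - p))) * e2

end LowerBounds

/-! ### Positivity, convexity and doubling of the cusp function. -/

section CuspFunctions

variable {w : ℝ → ℝ}

/-- A zero at `t > 0` would spread by doubling to every `2 ^ k * t`, contradicting `w 1 = 1` by
monotonicity. -/
theorem IsDoublingCuspFunction.pos (hw : IsDoublingCuspFunction w) {t : ℝ} (ht : 0 < t) :
    0 < w t := by
  obtain ⟨C, hC⟩ := hw.doubling
  by_contra! h
  have h0 : ∀ s, 0 < s → 0 ≤ w s := fun s hs => by
    rw [← hw.map_zero]; exact hw.monotoneOn self_mem_Ici hs.le hs.le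
  have hk : ∀ k : ℕ, w (2 ^ k * t) = 0 := fun k => by
    induction k with
    | zero => simpa using le_antisymm h (h0 t ht)
    | succ k ih =>
      have := hC (2 ^ k * t) (by positivity)
      rw [ih, mul_zero, ← mul_assoc, ← pow_succ'] at this
      exact le_antisymm this (h0 _ (by positivity))
  obtain ⟨k, hk1⟩ := pow_unbounded_of_one_lt (1 / t) (one_lt_two : (1 : ℝ) < 2)
  rw [div_lt_iff₀ ht] at hk1
  have := hw.monotoneOn (mem_Ici.2 zero_le_one) (mem_Ici.2 (by positivity)) hk1.le
  rw [hk k, hw.map_one] at this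
  linarith

theorem IsDoublingCuspFunction.mono (hw : IsDoublingCuspFunction w) {s t : ℝ} (hs : 0 ≤ s)
    (hst : s ≤ t) : w s ≤ w t :=
  hw.monotoneOn hs (hs.trans hst) hst

theorem IsDoublingCuspFunction.convexOn (hw : IsDoublingCuspFunction w) :
    ConvexOn ℝ (Icc 0 1) w := by
  refine MonotoneOn.convexOn_of_deriv (convex_Icc 0 1) (hw.continuousOn.mono Icc_subset_Ici_self)
    ?_ ?_
  · rw [interior_Icc]
    exact fun t ht => (hw.differentiableAt t ht.1).differentiableWithinAt
  · rw [interior_Icc]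
    exact hw.deriv_monotoneOn

theorem IsDoublingCuspFunction.div_le_div (hw : IsDoublingCuspFunction w) {s t : ℝ} (hs : 0 < s)
    (hst : s ≤ t) (ht : t ≤ 1) : w s / s ≤ w t / t := by
  have := hw.convexOn.secant_mono (a := 0) (x := s) (y := t) ⟨le_rfl, zero_le_one⟩
    ⟨hs.le, hst.trans ht⟩ ⟨(hs.trans_le hst).le, ht⟩ hs.ne' (hs.trans_le hst).ne' hst
  simpa [hw.map_zero] using this

/-- Since `w'` tends to `0`, some small `s` has `w s < s`, so the secant from `s` to `1` has slope
above `1`. By convexity the secant from `t ≥ s` to `1` is at least as steep. -/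
theorem IsDoublingCuspFunction.lt_self (hw : IsDoublingCuspFunction w) {t : ℝ} (ht : 0 < t)
    (ht1 : t < 1) : w t < t := by
  have hev : ∀ᶠ s in 𝓝[>] (0 : ℝ), deriv w s < 1 / 2 :=
    hw.tendsto_deriv.eventually (gt_mem_nhds (by norm_num))
  obtain ⟨ε, hε, hsub⟩ := mem_nhdsGT_iff_exists_Ioo_subset.1 hev
  set s := min (ε / 2) (t / 2)
  have hε' : 0 < ε := hε
  have hs : 0 < s := by positivity
  have hst : s < t := (min_le_right _ _).trans_lt (half_lt_self ht)
  obtain ⟨ξ, hξ, hξs⟩ := exists_deriv_eq_slope w hs (hw.continuousOn.mono Icc_subset_Ici_self)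
    fun x hx => (hw.differentiableAt x hx.1).differentiableWithinAt
  have hlt : deriv w ξ < 1 / 2 :=
    hsub ⟨hξ.1, hξ.2.trans ((min_le_left _ _).trans_lt (half_lt_self hε'))⟩
  rw [hξs, hw.map_zero, sub_zero, sub_zero, div_lt_iff₀ hs] at hlt
  have hconv := hw.convexOn.secant_mono (a := 1) (x := s) (y := t) ⟨zero_le_one, le_rfl⟩
    ⟨hs.le, (hst.trans ht1).le⟩ ⟨ht.le, ht1.le⟩ (hst.trans ht1).ne ht1.ne hst.le
  have h1 : 1 < (w s - w 1) / (s - 1) := by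
    rw [lt_div_iff_of_neg (by linarith), hw.map_one]
    linarith
  have h2 := h1.trans_le hconv
  rw [lt_div_iff_of_neg (by linarith), hw.map_one] at h2
  linarith

/-- Three doublings. The point `r / 8` is the bottom height of the thin cylinders, whose radius is
`w (r / 8)`. -/
theorem IsDoublingCuspFunction.exists_le_mul (hw : IsDoublingCuspFunction w) :
    ∃ C : ℝ, 1 ≤ C ∧ ∀ r, 0 < r → w r ≤ C * w (r / 8) := by
  obtain ⟨C, hC⟩ := hw.doubling
  set D := max C 1
  have hD : 1 ≤ D := le_max_right _ _
  have h : ∀ t, 0 < t → w (2 * t) ≤ D * w t := fun t ht =>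
    (hC t ht).trans (mul_le_mul_of_nonneg_right (le_max_left _ _) (hw.pos ht).le)
  refine ⟨D ^ 3, one_le_pow₀ hD, fun r hr => ?_⟩
  have h1 := h (r / 8) (by positivity)
  have h2 := h (2 * (r / 8)) (by positivity)
  have h3 := h (2 * (2 * (r / 8))) (by positivity)
  rw [show 2 * (2 * (2 * (r / 8))) = r by ring] at h3
  calc w r ≤ D * (D * (D * w (r / 8))) := by
        refine h3.trans ?_
        gcongr
        refine h2.trans ?_
        gcongr
    _ = _ := by ring

end CuspFunctions

/-! ### Position of the cusp relative to the two plates. -/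

section Cusps

variable {n : ℕ} [NeZero n] {w : ℝ → ℝ} {r : ℝ}

theorem cuspCapacityInside_le_cuspCapacity (p : ℝ) :
    cuspCapacityInside n w p r ≤ cuspCapacity n w p r :=
  varCapacity_mono_right inter_subset_right

theorem half_le_norm_of_mem_annulus {n : ℕ} {z : EuclideanSpace ℝ (Fin n)}
    (hz : z ∈ annulus 0 (r / 2) (3 * r / 4)) : r / 2 ≤ ‖z‖ := by
  have := hz.2
  rwa [mem_ball_zero_iff, not_lt] at this

theorem norm_le_of_mem_outwardCusp_inter_ball (hw : IsDoublingCuspFunction w) (hr1 : r < 1)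
    {z : EuclideanSpace ℝ (Fin n)} (hz : z ∈ outwardCusp n w ∩ Metric.ball 0 (r / 4)) :
    ‖z‖ ≤ r / 4 ∧ transversalNorm z ≤ w r := by
  obtain ⟨hz1, hz2⟩ := hz
  rw [mem_ball_zero_iff] at hz2
  refine ⟨hz2.le, ?_⟩
  have h0 := (abs_le.1 (abs_coord_zero_le_norm z)).2
  rcases hz1 with ⟨h1, -, h3⟩ | h
  · exact h3.le.trans (hw.mono h1.le (by linarith [norm_nonneg z]))
  -- The ball around `(2, 0)` lies at distance `2 - √2 > 1 / 2` from the origin, so it misses `B(0,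
  -- r / 4)`.
  · exfalso
    rw [mem_ball_iff_norm] at h
    have h4 := norm_sub_norm_le (EuclideanSpace.single (0 : Fin n) (2 : ℝ)) z
    rw [norm_sub_rev, PiLp.norm_single] at h4
    have : Real.sqrt 2 < 3 / 2 := by
      rw [Real.sqrt_lt' (by norm_num)]; norm_num
    norm_num at h4
    linarith

theorem mem_outwardCusp_inter_ball (hw : IsDoublingCuspFunction w) (hr : 0 < r) (hr1 : r < 1)
    {z : EuclideanSpace ℝ (Fin n)} (h1 : r / 8 ≤ z 0) (h2 : z 0 ≤ 3 * r / 16)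
    (h3 : transversalNorm z < w (r / 8)) : z ∈ outwardCusp n w ∩ Metric.ball 0 (r / 4) := by
  refine ⟨Or.inl ⟨by linarith, by linarith, h3.trans_le (hw.mono (by positivity) h1)⟩, ?_⟩
  rw [mem_ball_zero_iff]
  refine abs_lt_of_sq_lt_sq' ?_ (by positivity) |>.2
  rw [norm_sq_eq_add_transversalNorm_sq]
  have h4 := h3.trans (hw.lt_self (t := r / 8) (by positivity) (by linarith))
  have := transversalNorm_nonneg z
  nlinarith

theorem mem_outwardCusp_inter_annulus (hw : IsDoublingCuspFunction w) (hr : 0 < r) (hr1 : r < 1)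
    {z : EuclideanSpace ℝ (Fin n)} (h1 : r / 2 ≤ z 0) (h2 : z 0 ≤ 5 * r / 8)
    (h3 : transversalNorm z < w (r / 8)) :
    z ∈ outwardCusp n w ∩ annulus 0 (r / 2) (3 * r / 4) := by
  refine ⟨Or.inl ⟨by linarith, by linarith,
    h3.trans_le (hw.mono (by positivity) (by linarith))⟩, ?_, ?_⟩
  · rw [mem_ball_zero_iff]
    refine abs_lt_of_sq_lt_sq' ?_ (by positivity) |>.2
    rw [norm_sq_eq_add_transversalNorm_sq]
    have h4 := h3.trans (hw.lt_self (t := r / 8) (by positivity) (by linarith))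
    have := transversalNorm_nonneg z
    nlinarith
  · rw [mem_ball_zero_iff, not_lt]
    exact h1.trans ((le_abs_self _).trans (abs_coord_zero_le_norm z))

end Cusps

/-! ### The three ranges of `p` and the comparison constants. -/

section Assembly

theorem exists_comparable {S : Set ℝ} {K₁ K₂ : ℝ → ℝ≥0∞} {Φ : ℝ → ℝ} {c₁ c₂ : ℝ} (hc₁ : 0 < c₁)
    (hc₂ : 0 < c₂) (h : ∀ r ∈ S, K₁ r ≤ K₂ r ∧ ENNReal.ofReal (c₁ * Φ r) ≤ K₁ r ∧
      K₂ r ≤ ENNReal.ofReal (c₂ * Φ r)) :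
    ∃ c : ℝ≥0, 1 < c ∧ ∀ r ∈ S, Comparable c (K₁ r) (K₂ r) ∧
      Comparable c (K₂ r) (ENNReal.ofReal (Φ r)) := by
  set c := 1 + c₂ / c₁ + c₂ + 1 / c₁ with hc
  have hd : 0 < c₂ / c₁ := by positivity
  have hd' : 0 < 1 / c₁ := by positivity
  have hc1 : 1 < c := by linarith
  have hcoe : ((Real.toNNReal c : ℝ≥0) : ℝ≥0∞) = ENNReal.ofReal c := rfl
  have hone : 1 ≤ ENNReal.ofReal c := ENNReal.one_le_ofReal.2 hc1.le
  have hdiv : ∀ A B : ℝ≥0∞, A ≤ ENNReal.ofReal c * B → A / ENNReal.ofReal c ≤ B := fun A B hAB =>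
    ENNReal.div_le_of_le_mul' hAB
  refine ⟨Real.toNNReal c, Real.one_lt_toNNReal.2 hc1, fun r hr => ?_⟩
  obtain ⟨h12, hlow, hup⟩ := h r hr
  have hΦ : ENNReal.ofReal (Φ r) ≤ ENNReal.ofReal c * K₁ r := by
    calc ENNReal.ofReal (Φ r) = ENNReal.ofReal (1 / c₁) * ENNReal.ofReal (c₁ * Φ r) := by
          rw [← ENNReal.ofReal_mul (by positivity)]; congr 1; field_simp
      _ ≤ _ := by gcongr; linarith
  unfold Comparable
  rw [hcoe]
  refine ⟨⟨hdiv _ _ (h12.trans (le_mul_of_one_le_left' hone)), ?_⟩, hdiv _ _ ?_, ?_⟩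
  · calc K₂ r ≤ ENNReal.ofReal (c₂ / c₁) * ENNReal.ofReal (c₁ * Φ r) := by
          rw [← ENNReal.ofReal_mul (by positivity)]
          refine hup.trans (ENNReal.ofReal_le_ofReal (le_of_eq ?_)); field_simp
      _ ≤ _ := by gcongr; linarith
  · rw [ENNReal.ofReal_mul (by positivity)] at hup
    refine hup.trans ?_
    gcongr
    linarith
  · exact hΦ.trans (by gcongr)

variable {n : ℕ} [NeZero n] {w : ℝ → ℝ} {p : ℝ}

theorem integral_rpow_eq {a r γ : ℝ} (ha : 0 < a) (har : a ≤ r) (hγ : γ ≠ 0) :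
    ∫ τ in a..r, τ ^ (γ - 1) = (r ^ γ - a ^ γ) / γ := by
  rw [integral_rpow, sub_add_cancel]
  right
  refine ⟨fun h => hγ (by linarith), ?_⟩
  rw [uIcc_of_le har]
  exact fun h => (ha.trans_le h.1).ne' rfl

theorem integral_rpow_neg_one {a r : ℝ} (ha : 0 < a) (hr : 0 < r) :
    ∫ τ in a..r, τ ^ ((0 : ℝ) - 1) = Real.log (r / a) := by
  rw [← integral_inv_of_pos ha hr]
  congr 1
  ext τ
  rw [zero_sub, Real.rpow_neg_one]

/-- The radial competitor works for every `p ≥ 0`; besides `p > n - 1`, it serves `p = n - 1` when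
`r / w r` is bounded. -/
theorem exists_cuspCapacity_le_rpow (n : ℕ) [NeZero n] (hp : 0 ≤ p) : ∃ c, 0 < c ∧
    ∀ {w : ℝ → ℝ}, IsDoublingCuspFunction w → ∀ r, 0 < r → r < 1 →
    cuspCapacity n w p r ≤ ENNReal.ofReal (c * r ^ ((n : ℝ) - p)) := by
  refine ⟨4 ^ p * 2 ^ n, by positivity, fun hw r hr hr1 => ?_⟩
  refine (varCapacity_le_radial hp hr
    (fun x hx => (norm_le_of_mem_outwardCusp_inter_ball hw hr1 hx).1)
    fun x hx => half_le_norm_of_mem_annulus hx).trans (ENNReal.ofReal_le_ofReal (le_of_eq ?_))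
  have hn : n = n - 1 + 1 := (Nat.sub_add_cancel (Nat.one_le_iff_ne_zero.2 (NeZero.ne n))).symm
  rw [← pow_succ', ← hn, Real.rpow_sub hr, Real.div_rpow (by norm_num) hr.le, mul_pow,
    Real.rpow_natCast]
  ring

theorem exists_bounds_of_gt (hn : 3 ≤ n) (hw : IsDoublingCuspFunction w) (hp : (n : ℝ) - 1 < p) :
    ∃ c₁ c₂ : ℝ, 0 < c₁ ∧ 0 < c₂ ∧ ∀ r, 0 < r → r < 1 →
      ENNReal.ofReal (c₁ * r ^ ((n : ℝ) - p)) ≤ cuspCapacityInside n w p r ∧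
      cuspCapacity n w p r ≤ ENNReal.ofReal (c₂ * r ^ ((n : ℝ) - p)) := by
  have hn' : (3 : ℝ) ≤ n := by exact_mod_cast hn
  obtain ⟨c₂, hc₂, hup⟩ := exists_cuspCapacity_le_rpow (p := p) n (by linarith)
  obtain ⟨c₁, hc₁, hlow⟩ := exists_le_varCapacity hn (p := p) (by linarith)
  have hp1 : 0 < p - 1 := by linarith
  have hβ0 : 0 < ((n : ℝ) - 2) * p / (p - 1) := div_pos (mul_pos (by linarith) (by linarith)) hp1
  have hγ0 : 0 < (n : ℝ) - 1 - ((n : ℝ) - 2) * p / (p - 1) := by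
    rw [sub_pos, div_lt_iff₀ hp1]; nlinarith
  set β := ((n : ℝ) - 2) * p / (p - 1) with hβ
  set γ := (n : ℝ) - 1 - β with hγ
  refine ⟨c₁ * (1 + β / γ) ^ (1 - p), c₂, by positivity, hc₂, fun r hr hr1 => ⟨?_, hup hw r hr hr1⟩⟩
  have ha := hw.pos (t := r / 8) (by positivity)
  have har := hw.lt_self (t := r / 8) (by positivity) (by linarith)
  refine le_trans (ENNReal.ofReal_le_ofReal (le_of_eq ?_)) (hlow ha (by linarith)
    (fun z => mem_outwardCusp_inter_ball hw hr hr1)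
    (fun z => mem_outwardCusp_inter_annulus hw hr hr1) (B := (1 + β / γ) * r ^ γ)
    (by positivity) ?_)
  · rw [Real.mul_rpow (by positivity) (by positivity), ← Real.rpow_mul hr.le]
    -- The choice of `β` gives `γ * (1 - p) = n - 1 - p`, which turns `r * B ^ (1 - p)` into the
    -- stated power.
    have : (n : ℝ) - p = 1 + γ * (1 - p) := by
      rw [hγ, hβ]; field_simp; ring
    rw [this, Real.rpow_add hr, Real.rpow_one]
    ring
  · rw [integral_rpow_eq ha (by linarith) hγ0.ne']
    have : 0 ≤ w (r / 8) ^ γ := by positivity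
    have h2 : β * ((r ^ γ - w (r / 8) ^ γ) / γ) ≤ β * (r ^ γ / γ) := by gcongr; linarith
    refine (add_le_add_right h2 _).trans (le_of_eq ?_)
    ring

theorem exists_le_cuspCapacityInside_of_lt (hn : 3 ≤ n) (hw : IsDoublingCuspFunction w)
    (hp : 1 ≤ p) (hpn : p < (n : ℝ) - 1) :
    ∃ c : ℝ, 0 < c ∧ ∀ r, 0 < r → r < 1 →
      ENNReal.ofReal (c * (r * w (r / 8) ^ ((n : ℝ) - 1 - p))) ≤ cuspCapacityInside n w p r := by
  rcases hp.eq_or_lt with rfl | hp1'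
  · obtain ⟨c, hc, h⟩ := exists_le_varCapacity_one (n := n) (by omega)
    refine ⟨c, hc, fun r hr hr1 => ?_⟩
    have ha := hw.pos (t := r / 8) (by positivity)
    have har := hw.lt_self (t := r / 8) (by positivity) (by linarith)
    have he : (n : ℝ) - 1 - 1 = ((n - 2 : ℕ) : ℝ) := by
      rw [Nat.cast_sub (by omega)]; push_cast; ring
    rw [he, Real.rpow_natCast]
    exact h ha (by linarith) (fun z => mem_outwardCusp_inter_ball hw hr hr1)
      (fun z => mem_outwardCusp_inter_annulus hw hr hr1)
  have hn' : (3 : ℝ) ≤ n := by exact_mod_cast hn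
  obtain ⟨c₁, hc₁, hlow⟩ := exists_le_varCapacity hn hp1'
  have hp1 : 0 < p - 1 := by linarith
  have hβ0 : 0 < ((n : ℝ) - 2) * p / (p - 1) := div_pos (mul_pos (by linarith) (by linarith)) hp1
  have hγ0 : 0 < ((n : ℝ) - 2) * p / (p - 1) - ((n : ℝ) - 1) := by
    rw [sub_pos, lt_div_iff₀ hp1]; nlinarith
  set β := ((n : ℝ) - 2) * p / (p - 1) with hβ
  set γ := (n : ℝ) - 1 - β with hγ
  have hγneg : γ < 0 := by linarith
  have hnegγ : 0 < -γ := by linarith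
  refine ⟨c₁ * (1 + β / -γ) ^ (1 - p), by positivity, fun r hr hr1 => ?_⟩
  have ha := hw.pos (t := r / 8) (by positivity)
  have har := hw.lt_self (t := r / 8) (by positivity) (by linarith)
  refine le_trans (ENNReal.ofReal_le_ofReal (le_of_eq ?_)) (hlow ha (by linarith)
    (fun z => mem_outwardCusp_inter_ball hw hr hr1)
    -- Here `γ < 0`, so the small scale `a = w (r / 8)` dominates both `r ^ γ` and the integral.
    (fun z => mem_outwardCusp_inter_annulus hw hr hr1) (B := (1 + β / -γ) * w (r / 8) ^ γ)
    (by positivity) ?_)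
  · rw [Real.mul_rpow (by positivity) (by positivity), ← Real.rpow_mul ha.le]
    have : (n : ℝ) - 1 - p = γ * (1 - p) := by
      rw [hγ, hβ]; field_simp; ring
    rw [this]
    ring
  · rw [integral_rpow_eq ha (by linarith) hγneg.ne]
    have h1 : r ^ γ ≤ w (r / 8) ^ γ := Real.rpow_le_rpow_of_nonpos ha (by linarith) hγneg.le
    have h0 : 0 ≤ r ^ γ := by positivity
    have e : (r ^ γ - w (r / 8) ^ γ) / γ = (w (r / 8) ^ γ - r ^ γ) / -γ := by
      rw [div_neg, ← neg_div, neg_sub]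
    have h2 : β * ((w (r / 8) ^ γ - r ^ γ) / -γ) ≤ β * (w (r / 8) ^ γ / -γ) := by gcongr; linarith
    rw [e]
    refine (add_le_add h1 h2).trans (le_of_eq ?_)
    ring

theorem exists_bounds_of_lt (hn : 3 ≤ n) (hw : IsDoublingCuspFunction w) (hp : 1 ≤ p)
    (hpn : p < (n : ℝ) - 1) :
    ∃ c₁ c₂ : ℝ, 0 < c₁ ∧ 0 < c₂ ∧ ∀ r, 0 < r → r < 1 →
      ENNReal.ofReal (c₁ * (r * w r ^ ((n : ℝ) - 1 - p))) ≤ cuspCapacityInside n w p r ∧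
      cuspCapacity n w p r ≤ ENNReal.ofReal (c₂ * (r * w r ^ ((n : ℝ) - 1 - p))) := by
  obtain ⟨c, hc, hlow⟩ := exists_le_cuspCapacityInside_of_lt hn hw hp hpn
  obtain ⟨C, hC, hdoub⟩ := hw.exists_le_mul
  set κ := (n : ℝ) - 1 - p with hκ
  have hκ0 : 0 ≤ κ := by linarith
  refine ⟨c / C ^ κ, 4 ^ p * 2 * 4 ^ (n - 1), by positivity, by positivity, fun r hr hr1 => ⟨?_, ?_⟩⟩
  · refine le_trans (ENNReal.ofReal_le_ofReal ?_) (hlow r hr hr1)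
    have ha := hw.pos (t := r / 8) (by positivity)
    have hwr := hw.pos hr
    have h1 : w r ^ κ ≤ C ^ κ * w (r / 8) ^ κ := by
      rw [← Real.mul_rpow (by positivity) ha.le]
      gcongr
      exact hdoub r hr
    calc c / C ^ κ * (r * w r ^ κ) ≤ c / C ^ κ * (r * (C ^ κ * w (r / 8) ^ κ)) := by gcongr
      _ = _ := by field_simp
  · have hwr := hw.pos hr
    refine (varCapacity_le_cylindrical (by linarith) hwr (hw.lt_self hr hr1).le
      (fun x hx => norm_le_of_mem_outwardCusp_inter_ball hw hr1 hx)
      fun x hx => half_le_norm_of_mem_annulus hx).trans (ENNReal.ofReal_le_ofReal (le_of_eq ?_))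
    have he : (n : ℝ) - 1 = ((n - 1 : ℕ) : ℝ) := by rw [Nat.cast_sub (by omega), Nat.cast_one]
    rw [hκ, Real.rpow_sub hwr, he, Real.rpow_natCast, Real.div_rpow (by norm_num) hwr.le,
      ← mul_assoc 2 2, mul_pow]
    norm_num
    ring

/-- The logarithm is shifted by `1` because the quantity `r / log (r / w r) ^ (n - 2)` may blow up
as `r → 1`, where `w 1 = 1`, while the capacity stays bounded. With the shift the two-sided bound
holds on all of `(0, 1)`. -/
theorem exists_bounds_of_eq (hn : 3 ≤ n) (hw : IsDoublingCuspFunction w) (hp : p = (n : ℝ) - 1) :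
    ∃ c₁ c₂ : ℝ, 0 < c₁ ∧ 0 < c₂ ∧ ∀ r, 0 < r → r < 1 →
      ENNReal.ofReal (c₁ * (r / (1 + Real.log (r / w r)) ^ (n - 2))) ≤ cuspCapacityInside n w p r ∧
      cuspCapacity n w p r ≤ ENNReal.ofReal (c₂ * (r / (1 + Real.log (r / w r)) ^ (n - 2))) := by
  have hn' : (3 : ℝ) ≤ n := by exact_mod_cast hn
  obtain ⟨c₃, hc₃, hup⟩ := exists_cuspCapacity_le_rpow (p := p) n (by linarith)
  obtain ⟨c₁, hc₁, hlow⟩ := exists_le_varCapacity hn (p := p) (by linarith)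
  obtain ⟨C, hC, hdoub⟩ := hw.exists_le_mul
  have hp1 : 0 < p - 1 := by linarith
  have hp0 : 0 < p := by linarith
  have hlogC : 0 ≤ Real.log C := Real.log_nonneg hC
  have hn1 : n - 1 = n - 2 + 1 := by omega
  have he : ((n - 1 : ℕ) : ℝ) = p := by rw [hp, Nat.cast_sub (by omega), Nat.cast_one]
  refine ⟨c₁ * (p * (1 + Real.log C)) ^ (1 - p), c₃ * 2 ^ (n - 2) + 12 ^ p * 2 ^ n * (1 + p),
    by positivity, by positivity, fun r hr hr1 => ?_⟩
  have ha := hw.pos (t := r / 8) (by positivity)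
  have har := hw.lt_self (t := r / 8) (by positivity) (by linarith)
  have hwr := hw.pos hr
  have hwlt := hw.lt_self hr hr1
  set L := Real.log (r / w r) with hL_def
  have hL : 0 < L := Real.log_pos ((one_lt_div hwr).2 hwlt)
  constructor
  · refine le_trans (ENNReal.ofReal_le_ofReal (le_of_eq ?_)) (hlow ha (by linarith)
      (fun z => mem_outwardCusp_inter_ball hw hr hr1)
      (fun z => mem_outwardCusp_inter_annulus hw hr hr1)
      (B := p * (1 + Real.log C) * (1 + L)) (by positivity) ?_)
    · rw [Real.mul_rpow (y := 1 + L) (by positivity) (by positivity)]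
      have : (1 + L) ^ (1 - p) = ((1 + L) ^ (n - 2))⁻¹ := by
        rw [← Real.rpow_natCast, ← Real.rpow_neg (by positivity)]
        congr 1
        rw [hp, Nat.cast_sub (by omega)]
        push_cast
        ring
      rw [this]
      ring
    · have hβ : ((n : ℝ) - 2) * p / (p - 1) = p := by
        rw [div_eq_iff hp1.ne', hp]; ring
      rw [hβ, ← hp, sub_self, Real.rpow_zero, integral_rpow_neg_one ha hr]
      have h1 : Real.log (r / w (r / 8)) ≤ Real.log C + L := by
        rw [hL_def, ← Real.log_mul (by positivity) (by positivity)]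
        refine Real.log_le_log (by positivity) ?_
        rw [div_le_iff₀ ha]
        calc r = r / w r * w r := by field_simp
          _ ≤ r / w r * (C * w (r / 8)) := by gcongr; exact hdoub r hr
          _ = _ := by ring
      have h2 : 0 ≤ p * (Real.log C * L) := by positivity
      have h3 : 1 ≤ p := by linarith
      nlinarith [mul_le_mul_of_nonneg_left h1 hp0.le]
  · have hΦ : 0 ≤ r / (1 + L) ^ (n - 2) := by positivity
    -- For `L ≤ 1` the factor `(1 + L) ^ (n - 2)` is at most `2 ^ (n - 2)` and the radial competitor
    -- suffices; for `L > 1` the logarithmic one is used, and `1 + L ≤ 2 * L` turns the `6` into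
    -- `12`.
    rcases le_or_gt L 1 with hL1 | hL1
    · refine (hup hw r hr hr1).trans (ENNReal.ofReal_le_ofReal ?_)
      have hr' : r ^ ((n : ℝ) - p) = r := by
        rw [hp, sub_sub_cancel, Real.rpow_one]
      have h1 : r ≤ 2 ^ (n - 2) * (r / (1 + L) ^ (n - 2)) := by
        rw [← mul_div_assoc, le_div_iff₀ (by positivity), mul_comm]
        gcongr
        linarith
      rw [hr', add_mul]
      have h2 : 0 ≤ 12 ^ p * 2 ^ n * (1 + p) * (r / (1 + L) ^ (n - 2)) := by positivity
      have h3 := mul_le_mul_of_nonneg_left h1 hc₃.le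
      linarith
    · refine (varCapacity_le_logarithmic hp0 hwr hwlt
        (fun x hx => norm_le_of_mem_outwardCusp_inter_ball hw hr1 hx)
        fun x hx => half_le_norm_of_mem_annulus hx).trans (ENNReal.ofReal_le_ofReal ?_)
      rw [he, sub_self, Real.rpow_zero, integral_rpow_neg_one hwr hr, ← hL_def]
      have h1 : (6 / L) ^ p ≤ 12 ^ p / ((1 + L) ^ (n - 2) * (1 + L)) := by
        rw [← pow_succ, ← hn1, ← Real.rpow_natCast, he, ← Real.div_rpow (by norm_num) (by positivity)]
        refine Real.rpow_le_rpow (by positivity) ?_ hp0.le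
        rw [div_le_div_iff₀ hL (by positivity)]
        linarith
      calc _ ≤ 12 ^ p / ((1 + L) ^ (n - 2) * (1 + L)) * (2 ^ n * r * ((1 + p) * (1 + L))) := by
            gcongr
            nlinarith
        _ = 12 ^ p * 2 ^ n * (1 + p) * (r / (1 + L) ^ (n - 2)) := by field_simp
        _ ≤ _ := by
            gcongr
            have : 0 ≤ c₃ * 2 ^ (n - 2) := by positivity
            linarith

end Assembly

theorem mainTheorem9 {n : ℕ} [NeZero n] (hn : 3 ≤ n) {w : ℝ → ℝ} (hw : IsDoublingCuspFunction w)
    {p : ℝ} (hp : 1 ≤ p) :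
    (∃ c : ℝ≥0, 1 < c ∧ ∀ r : ℝ, 0 < r → r < 1 →
      Comparable c (cuspCapacityInside n w p r) (cuspCapacity n w p r) ∧
      ((n : ℝ) - 1 < p →
        Comparable c (cuspCapacity n w p r) (ENNReal.ofReal (r ^ ((n : ℝ) - p)))) ∧
      (p = (n : ℝ) - 1 →
        cuspCapacity n w p r ≤
          (c : ℝ≥0∞) * ENNReal.ofReal (r / Real.log (r / w r) ^ (n - 2))) ∧
      (p < (n : ℝ) - 1 →
        Comparable c (cuspCapacity n w p r) (ENNReal.ofReal (r * w r ^ ((n : ℝ) - 1 - p))))) ∧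
    (p = (n : ℝ) - 1 → ∀ r₀ : ℝ, 0 < r₀ → r₀ < 1 →
      ∃ c : ℝ≥0, 1 < c ∧ ∀ r : ℝ, 0 < r → r ≤ r₀ →
        Comparable c (cuspCapacity n w p r)
          (ENNReal.ofReal (r / Real.log (r / w r) ^ (n - 2)))) := by
  have hlog : ∀ r, 0 < r → r < 1 → 0 < Real.log (r / w r) := fun r hr hr1 =>
    Real.log_pos ((one_lt_div (hw.pos hr)).2 (hw.lt_self hr hr1))
  refine ⟨?_, ?_⟩
  · rcases lt_trichotomy p ((n : ℝ) - 1) with hpn | hpn | hpn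
    · obtain ⟨c₁, c₂, hc₁, hc₂, hb⟩ := exists_bounds_of_lt hn hw hp hpn
      obtain ⟨c, hc, h⟩ := exists_comparable (S := Ioo 0 1) hc₁ hc₂ fun r hr =>
        ⟨cuspCapacityInside_le_cuspCapacity p, hb r hr.1 hr.2⟩
      exact ⟨c, hc, fun r hr hr1 => ⟨(h r ⟨hr, hr1⟩).1, fun h' => absurd hpn h'.not_gt,
        fun h' => absurd h' hpn.ne, fun _ => (h r ⟨hr, hr1⟩).2⟩⟩
    · obtain ⟨c₁, c₂, hc₁, hc₂, hb⟩ := exists_bounds_of_eq hn hw hpn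
      obtain ⟨c, hc, h⟩ := exists_comparable (S := Ioo 0 1) hc₁ hc₂ fun r hr =>
        ⟨cuspCapacityInside_le_cuspCapacity p, hb r hr.1 hr.2⟩
      refine ⟨c, hc, fun r hr hr1 => ⟨(h r ⟨hr, hr1⟩).1, fun h' => absurd hpn h'.ne', fun _ => ?_,
        fun h' => absurd hpn h'.ne⟩⟩
      have hcpos : (c : ℝ≥0∞) ≠ 0 := by
        exact_mod_cast (zero_lt_one.trans hc).ne'
      have h2 := (h r ⟨hr, hr1⟩).2.1
      rw [ENNReal.div_le_iff hcpos ENNReal.coe_ne_top, mul_comm] at h2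
      refine h2.trans ?_
      have := hlog r hr hr1
      gcongr
      linarith
    · obtain ⟨c₁, c₂, hc₁, hc₂, hb⟩ := exists_bounds_of_gt hn hw hpn
      obtain ⟨c, hc, h⟩ := exists_comparable (S := Ioo 0 1) hc₁ hc₂ fun r hr =>
        ⟨cuspCapacityInside_le_cuspCapacity p, hb r hr.1 hr.2⟩
      exact ⟨c, hc, fun r hr hr1 => ⟨(h r ⟨hr, hr1⟩).1, fun _ => (h r ⟨hr, hr1⟩).2,
        fun h' => absurd h' hpn.ne', fun h' => absurd hpn h'.not_gt⟩⟩
  · intro hpn r₀ hr₀ hr₀1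
    obtain ⟨c₁, c₂, hc₁, hc₂, hb⟩ := exists_bounds_of_eq hn hw hpn
    set δ := Real.log (r₀ / w r₀)
    have hδ : 0 < δ := hlog r₀ hr₀ hr₀1
    obtain ⟨c, hc, h⟩ := exists_comparable (S := Ioc 0 r₀)
      (Φ := fun r => r / Real.log (r / w r) ^ (n - 2)) (K₁ := cuspCapacityInside n w p)
      (K₂ := cuspCapacity n w p) (c₁ := c₁ / (1 + 1 / δ) ^ (n - 2)) (by positivity) hc₂ fun r hr => by
        have hr1 : r < 1 := hr.2.trans_lt hr₀1
        have hr0 := hr.1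
        have hL := hlog r hr.1 hr1
        obtain ⟨hlow, hup⟩ := hb r hr.1 hr1
        refine ⟨cuspCapacityInside_le_cuspCapacity p, le_trans (ENNReal.ofReal_le_ofReal ?_) hlow,
          hup.trans (ENNReal.ofReal_le_ofReal ?_)⟩
        -- By convexity `w t / t` is increasing, so on `(0, r₀]` the logarithm is at least its value
        -- `δ` at `r₀`, and the shift by `1` costs only a factor `1 + 1 / δ`.
        · have hδL : δ ≤ Real.log (r / w r) := by
            have hwr := hw.pos hr.1
            have hwr₀ := hw.pos hr₀
            refine Real.log_le_log (by positivity) ?_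
            have := hw.div_le_div hr.1 hr.2 hr₀1.le
            rw [← inv_div, ← inv_div (w r)]
            gcongr
          have h1 : 1 + Real.log (r / w r) ≤ (1 + 1 / δ) * Real.log (r / w r) := by
            have : 1 ≤ 1 / δ * Real.log (r / w r) := by
              rw [one_div_mul_eq_div, one_le_div hδ]; exact hδL
            linarith
          calc _ = c₁ * (r / ((1 + 1 / δ) * Real.log (r / w r)) ^ (n - 2)) := by
                rw [mul_pow]; field_simp
            _ ≤ _ := by gcongr
        · gcongr
          linarith
    exact ⟨c, hc, fun r hr hr' => (h r ⟨hr, hr'⟩).2⟩
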